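/- Let $M\ge 1$ and let $M$ streams of updates be generated according to independent Poisson processes of rates $\lambda_1,\dots,\lambda_M>0$ starting at time $0$; put $\lambda=\lambda_1+\dots+\lambda_M$. The updates are sent to a monitor through an M/G/1/1 queue with preemption that is empty at time $0$: the service of an update starts at the moment of its generation, and it is dropped if any update (of the same or of another stream) is generated before its service is completed; otherwise it is called successful and is received by the monitor at the moment its service is completed. The service times of all updates are independent, have the law of a random variable $S\ge 0$ with an arbitrary distribution, and are independent of the generation times. Let $P_\lambda=\mathbb{E}(e^{-\lambda S})$. Fix a stream $i$. Its instantaneous age at time $t\ge 0$ is $\Delta_i(t)=t-u_i(t)$, where $u_i(t)$ is the generation time of the last update of stream $i$ received by time $t$ (before the first reception, $u_i(t)=-a_0$, where $a_0\ge 0$ is an arbitrary constant initial age). For $j\ge 1$ let $K^{(i)}_j$ be the $j$-th peak age, that is, the value of $\Delta_i$ right before (the left limit of $\Delta_i$ at) the time at which the $j$-th successful update of stream $i$ is received. Then, almost surely, $\Delta_i$ is integrable on bounded intervals, infinitely many updates of stream $i$ are successful, and \begin{enumerate} \item the average age of stream $i$ is $$\Delta_i=\lim_{\tau\to\infty}\frac1\tau\int_0^\tau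 \Delta_i(t)\,\mathrm{d}t=\frac{1}{\lambda_i P_\lambda};$$ \item the average peak age of stream $i$ is $$\Delta_{\mathrm{peak},i}=\lim_{N\to\infty}\frac1N\sum_{j=1}^N K^{(i)}_j=\frac{1}{\lambda_i P_\lambda}+\frac{\mathbb{E}(Se^{-\lambda S})}{P_\lambda}.$$ \end{enumerate} -/

import Mathlib

open MeasureTheory ProbabilityTheory Filter Topology

noncomputable section

namespace MG11

/-! ### Sample paths of the preemptive queue without buffer

A sample path is given by `x i n`, the time between the generations of the updates `n - 1` and `n`
of stream `i` (for `n = 0`: the time from the origin to the first generation), and by `s i n`, the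
service time required by update `n` of stream `i`.  The system is empty at time `0`. -/

variable {M : ℕ}

/-- Generation time of update `n` (counted from `0`) of stream `i`. -/
def genTime (x : Fin M → ℕ → ℝ) (i : Fin M) (n : ℕ) : ℝ :=
  ∑ k ∈ Finset.range (n + 1), x i k

/-- The time at which update `n` of stream `i` leaves the server unless it is preempted: service
starts at the generation time, since the new update preempts whatever is being served. -/
def depTime (x s : Fin M → ℕ → ℝ) (i : Fin M) (n : ℕ) : ℝ :=
  genTime x i n + s i n

/-- Update `n` of stream `i` is successful: its service is completed before the next generation of
an update of any stream (its own stream included), so that it is not preempted. -/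
def Successful (x s : Fin M → ℕ → ℝ) (i : Fin M) (n : ℕ) : Prop :=
  ∀ (j : Fin M) (m : ℕ), genTime x i n < genTime x j m → depTime x s i n < genTime x j m

/-- The generation time `u(t)` of the last update of stream `i` received by the monitor up to
time `t`.  Successful updates are received in the order of their generation, so this is the largest
generation time of a received update.  At time `0` the monitor holds an update of age `a₀`,
generated at time `-a₀`. -/
def lastGen (x s : Fin M → ℕ → ℝ) (a₀ : ℝ) (i : Fin M) (t : ℝ) : ℝ :=
  sSup (insert (-a₀) {g | ∃ n, Successful x s i n ∧ depTime x s i n ≤ t ∧ genTime x i n = g})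

/-- The instantaneous age `Δ(t) = t - u(t)` of stream `i`. -/
def age (x s : Fin M → ℕ → ℝ) (a₀ : ℝ) (i : Fin M) (t : ℝ) : ℝ :=
  t - lastGen x s a₀ i t

/-- The reception time of the `j`-th (counted from `0`) successful update of stream `i`. -/
def recTime (x s : Fin M → ℕ → ℝ) (i : Fin M) (j : ℕ) : ℝ :=
  depTime x s i (Nat.nth (Successful x s i) j)

/-- The `j`-th (counted from `0`) peak age of stream `i`: the value of the instantaneous age right
before the reception of the `j`-th successful update. -/
def peakAge (x s : Fin M → ℕ → ℝ) (a₀ : ℝ) (i : Fin M) (j : ℕ) : ℝ :=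
  Function.leftLim (age x s a₀ i) (recTime x s i j)

/-! ### The stochastic model -/

/-- `M` independent Poisson streams, stream `i` having rate `rate i` (independent exponential
interarrival times `X i n`), with independent service times `S i n` of common law `ν` on `[0, ∞)`,
independent of the arrivals. -/
structure IsModel {Ω : Type*} [MeasurableSpace Ω] (P : Measure Ω) (rate : Fin M → ℝ)
    (ν : Measure ℝ) (X S : Fin M → ℕ → Ω → ℝ) : Prop where
  rate_pos : ∀ i, 0 < rate i
  service_nonneg : ∀ᵐ t ∂ν, 0 ≤ t
  law_interarrival : ∀ i n, HasLaw (X i n) (expMeasure (rate i)) P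
  law_service : ∀ i n, HasLaw (S i n) ν P
  indep : iIndepFun (Sum.elim (fun p : Fin M × ℕ => X p.1 p.2) (fun p : Fin M × ℕ => S p.1 p.2)) P

/-- The Laplace transform of the service time law at `l`. -/
def laplace (ν : Measure ℝ) (l : ℝ) : ℝ := ∫ t, Real.exp (-l * t) ∂ν

end MG11

end

noncomputable section

namespace MG11

/-! ### Second-moment strong law for orthogonal sequences. -/

section General

variable {Ω : Type*} [MeasurableSpace Ω] {P : Measure Ω}

/-! Merge the streams. By memorylessness, at the first update overall the wait, the stream and its
service time, and the state left behind are independent, and that state has the law of a fresh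
system (`map_next_pathMeasure`). Iterating gives an i.i.d. sequence of triples (stream `J`, service
`S`, wait `W` until the next update), with `W` exponential of rate λ and `J = i` with probability
λ_i/λ. Update `n` is a success of stream `i` exactly when `J = i` and `S < W`, which has probability
`p` = (λ_i/λ) P_λ.

Average age. Let `A_n` be the time from the last successful generation before update `n` to that
update, and `c_n` the stale time: `S` on a success, `W` otherwise. The age integrates to `W_n²/2 +
A_n c_n` between updates `n` and `n + 1`, and `A_{n+1} = W_n + (1 - succ_n) A_n`. Since `A_n`
depends only on the past, `A_n (c_n - κ succ_n)` with κ = E c / E succ = (1-p)/(λp) is an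
`L²`-bounded orthogonal sequence, so its averages vanish (`ae_tendsto_average_of_orthogonal`). The
sum of `A_n succ_n` telescopes to the elapsed time minus `A_N` (`sum_succInd_mul_accum`), so the
average of `A_n c_n` is κ/λ. Adding E W²/2 = 1/λ² gives 1/(λ²p) per update; updates are 1/λ apart on
average, so the average age is 1/(λp) = 1/(λ_i P_λ). No regeneration argument is needed.

Peak age. A peak is the service time of the successful update plus the gap between successive
successful generations. The gaps telescope (`sum_departure_sub`), and division by the number of
successes gives (E(S; success) + 1/λ)/p.

The almost sure input is collected in `Typical`; the rest is deterministic sample path analysis. -/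

theorem ae_tendsto_zero_of_summable_integral_sq {Y : ℕ → Ω → ℝ}
    (hY : ∀ n, MemLp (Y n) 2 P) (hs : Summable fun n => ∫ ω, Y n ω ^ 2 ∂P) :
    ∀ᵐ ω ∂P, Tendsto (fun n => Y n ω) atTop (𝓝 0) := by
  have hm : ∀ n, AEMeasurable (fun ω => ENNReal.ofReal (Y n ω ^ 2)) P := fun n =>
    ((hY n).aestronglyMeasurable.aemeasurable.pow_const 2).ennreal_ofReal
  have hfin : ∫⁻ ω, ∑' n, ENNReal.ofReal (Y n ω ^ 2) ∂P ≠ ⊤ := by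
    rw [lintegral_tsum hm]
    have : ∀ n, ∫⁻ ω, ENNReal.ofReal (Y n ω ^ 2) ∂P = ENNReal.ofReal (∫ ω, Y n ω ^ 2 ∂P) :=
      fun n => (ofReal_integral_eq_lintegral_ofReal (hY n).integrable_sq
        (ae_of_all _ fun ω => sq_nonneg _)).symm
    simp_rw [this]
    exact hs.tsum_ofReal_ne_top
  filter_upwards [ae_lt_top' (AEMeasurable.tsum hm) hfin] with ω hω
  have h1 := ENNReal.tendsto_atTop_zero_of_tsum_ne_top hω.ne
  have h2 : Tendsto (fun n => Y n ω ^ 2) atTop (𝓝 0) := by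
    have := (ENNReal.tendsto_toReal (ENNReal.zero_ne_top)).comp h1
    simpa [Function.comp_def, ENNReal.toReal_ofReal (sq_nonneg _)] using this
  have h3 := (Real.continuous_sqrt.tendsto 0).comp h2
  simp only [Function.comp_def, Real.sqrt_sq_eq_abs, Real.sqrt_zero] at h3
  exact (tendsto_zero_iff_abs_tendsto_zero _).2 h3

theorem integral_sq_sum_of_orthogonal {D : ℕ → Ω → ℝ} (hD : ∀ n, MemLp (D n) 2 P)
    (ho : ∀ m n, m < n → ∫ ω, D m ω * D n ω ∂P = 0) (N : ℕ) :
    ∫ ω, (∑ k ∈ Finset.range N, D k ω) ^ 2 ∂P =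
      ∑ k ∈ Finset.range N, ∫ ω, D k ω ^ 2 ∂P := by
  induction N with
  | zero => simp
  | succ N ih =>
    have hS : MemLp (fun ω => ∑ k ∈ Finset.range N, D k ω) 2 P :=
      memLp_finsetSum _ fun k _ => hD k
    have hprod : ∀ k, Integrable (fun ω => D k ω * D N ω) P := fun k =>
      (hD k).integrable_mul (hD N)
    simp_rw [Finset.sum_range_succ]
    rw [← ih]
    have : ∀ ω, (∑ k ∈ Finset.range N, D k ω + D N ω) ^ 2 =
        (∑ k ∈ Finset.range N, D k ω) ^ 2 + 2 * (∑ k ∈ Finset.range N, D k ω * D N ω)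
          + D N ω ^ 2 := by
      intro ω; rw [← Finset.sum_mul]; ring
    simp_rw [this]
    have hcross : Integrable (fun ω => 2 * ∑ k ∈ Finset.range N, D k ω * D N ω) P :=
      (integrable_finsetSum _ fun k _ => hprod k).const_mul 2
    rw [integral_add (f := fun ω => (∑ k ∈ Finset.range N, D k ω) ^ 2 +
        2 * ∑ k ∈ Finset.range N, D k ω * D N ω) (hS.integrable_sq.add hcross) (hD N).integrable_sq,
      integral_add hS.integrable_sq hcross, integral_const_mul,
      integral_finsetSum _ fun k _ => hprod k,
      Finset.sum_eq_zero fun k hk => ho k N (Finset.mem_range.1 hk)]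
    simp

/-- Strong law of large numbers for orthogonal random variables bounded in `L²`. -/
theorem ae_tendsto_average_of_orthogonal {D : ℕ → Ω → ℝ} (hD : ∀ n, MemLp (D n) 2 P)
    (ho : ∀ m n, m < n → ∫ ω, D m ω * D n ω ∂P = 0) {C : ℝ}
    (hC : ∀ n, ∫ ω, D n ω ^ 2 ∂P ≤ C) :
    ∀ᵐ ω ∂P, Tendsto (fun N : ℕ => (∑ k ∈ Finset.range N, D k ω) / N) atTop (𝓝 0) := by
  have hC0 : 0 ≤ C := (integral_nonneg fun ω => sq_nonneg _).trans (hC 0)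
  -- Along squares the normalized sum has second moment at most `C / n²`, which is summable.
  have hY : ∀ᵐ ω ∂P, Tendsto (fun n : ℕ => (∑ k ∈ Finset.range (n ^ 2), D k ω) * ((n : ℝ) ^ 2)⁻¹)
      atTop (𝓝 0) := by
    apply ae_tendsto_zero_of_summable_integral_sq
    · intro n
      exact (memLp_finsetSum _ fun k _ => hD k).mul_const _
    · refine Summable.of_nonneg_of_le (fun n => integral_nonneg fun ω => sq_nonneg _)
        (fun n => ?_) ((Real.summable_nat_pow_inv.2 (one_lt_two)).mul_left C)
      simp_rw [mul_pow]
      rw [integral_mul_const, integral_sq_sum_of_orthogonal hD ho]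
      rcases Nat.eq_zero_or_pos n with rfl | hn
      · simp
      have hn' : (0 : ℝ) < n := by exact_mod_cast hn
      have h1 : ∑ k ∈ Finset.range (n ^ 2), ∫ ω, D k ω ^ 2 ∂P ≤ (n : ℝ) ^ 2 * C := by
        refine (Finset.sum_le_sum fun k _ => hC k).trans (le_of_eq ?_)
        simp
      calc _ ≤ ((n : ℝ) ^ 2 * C) * (((n : ℝ) ^ 2)⁻¹) ^ 2 := by gcongr
        _ = _ := by field_simp
  -- Between consecutive squares lie `2n + 1 ≤ 3n` terms; by Cauchy–Schwarz their absolute sum over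
  -- `n²` has second moment at most `9C / n²`.
  have hZ : ∀ᵐ ω ∂P, Tendsto (fun n : ℕ =>
      (∑ k ∈ Finset.Ico (n ^ 2) ((n + 1) ^ 2), |D k ω|) * ((n : ℝ) ^ 2)⁻¹) atTop (𝓝 0) := by
    apply ae_tendsto_zero_of_summable_integral_sq
    · intro n
      exact (memLp_finsetSum _ fun k _ => (hD k).abs).mul_const _
    · refine Summable.of_nonneg_of_le (fun n => integral_nonneg fun ω => sq_nonneg _)
        (fun n => ?_) ((Real.summable_nat_pow_inv.2 (one_lt_two)).mul_left (9 * C))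
      simp_rw [mul_pow]
      rw [integral_mul_const]
      rcases Nat.eq_zero_or_pos n with rfl | hn
      · simp
      have hn' : (1 : ℝ) ≤ n := by exact_mod_cast hn
      have hcard : ((Finset.Ico (n ^ 2) ((n + 1) ^ 2)).card : ℝ) = 2 * n + 1 := by
        rw [Nat.card_Ico, Nat.cast_sub (by gcongr; omega)]
        push_cast; ring
      have h1 : ∫ ω, (∑ k ∈ Finset.Ico (n ^ 2) ((n + 1) ^ 2), |D k ω|) ^ 2 ∂P ≤
          (2 * n + 1) * ((2 * n + 1) * C) := by
        calc _ ≤ ∫ ω, (2 * n + 1) * ∑ k ∈ Finset.Ico (n ^ 2) ((n + 1) ^ 2), D k ω ^ 2 ∂P := by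
              refine integral_mono (memLp_finsetSum _ fun k _ => (hD k).abs).integrable_sq
                ((integrable_finsetSum _ fun k _ => (hD k).integrable_sq).const_mul _)
                fun ω => ?_
              have := sq_sum_le_card_mul_sum_sq (s := Finset.Ico (n ^ 2) ((n + 1) ^ 2))
                (f := fun k => |D k ω|)
              rw [hcard] at this
              simpa only [sq_abs] using this
          _ = (2 * n + 1) * ∑ k ∈ Finset.Ico (n ^ 2) ((n + 1) ^ 2), ∫ ω, D k ω ^ 2 ∂P := by
              rw [integral_const_mul, integral_finsetSum _ fun k _ => (hD k).integrable_sq]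
          _ ≤ _ := by
              gcongr
              refine (Finset.sum_le_sum fun k _ => hC k).trans (le_of_eq ?_)
              simp only [Finset.sum_const, nsmul_eq_mul, hcard]
      calc _ ≤ ((2 * n + 1) * ((2 * n + 1) * C)) * (((n : ℝ) ^ 2)⁻¹) ^ 2 := by gcongr
        _ ≤ ((3 * n) * ((3 * n) * C)) * (((n : ℝ) ^ 2)⁻¹) ^ 2 := by gcongr <;> linarith
        _ = _ := by field_simp; ring
  filter_upwards [hY, hZ] with ω h1 h2
  have h3 : Tendsto (fun N : ℕ => |(∑ k ∈ Finset.range ((Nat.sqrt N) ^ 2), D k ω) *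
        (((Nat.sqrt N : ℕ) : ℝ) ^ 2)⁻¹| +
      (∑ k ∈ Finset.Ico ((Nat.sqrt N) ^ 2) ((Nat.sqrt N + 1) ^ 2), |D k ω|) *
        (((Nat.sqrt N : ℕ) : ℝ) ^ 2)⁻¹) atTop (𝓝 0) := by
    have hsq : Tendsto Nat.sqrt atTop atTop := by
      refine tendsto_atTop_atTop.2 fun b => ⟨b * b, fun a ha => ?_⟩
      exact Nat.le_sqrt.2 ha
    have := (h1.abs.add h2).comp hsq
    simpa [Function.comp_def] using this
  refine squeeze_zero_norm' ?_ h3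
  filter_upwards [eventually_ge_atTop 1] with N hN
  set n := Nat.sqrt N with hn
  have hn1 : 1 ≤ n := Nat.le_sqrt.2 (by simpa using hN)
  have hle : n ^ 2 ≤ N := by rw [pow_two]; exact Nat.sqrt_le N
  have hlt : N < (n + 1) ^ 2 := by rw [pow_two]; exact Nat.lt_succ_sqrt N
  have hle' : (n : ℝ) ^ 2 ≤ N := by exact_mod_cast hle
  have hnpos : (0 : ℝ) < (n : ℝ) ^ 2 := by positivity
  rw [Real.norm_eq_abs, abs_div, Nat.abs_cast, abs_mul, abs_of_pos (inv_pos.2 hnpos), ← add_mul,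
    div_eq_mul_inv]
  gcongr
  rw [← Finset.sum_range_add_sum_Ico _ hle]
  refine (abs_add_le _ _).trans ?_
  gcongr
  refine (Finset.abs_sum_le_sum_abs _ _).trans ?_
  exact Finset.sum_le_sum_of_subset_of_nonneg (Finset.Ico_subset_Ico_right hlt.le)
    fun _ _ _ => abs_nonneg _

end General

/-! ### Independent outputs of a stationary chain. -/

section Iterate

variable {E F : Type*} [MeasurableSpace E] [MeasurableSpace F] {μ : Measure E} {ρ : Measure F}
  {V : E → F} {T : E → E}

theorem measurePreserving_of_map_prodMk_eq [IsProbabilityMeasure ρ] [SFinite μ]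
    (hV : Measurable V) (hT : Measurable T)
    (h : μ.map (fun z => (V z, T z)) = ρ.prod μ) : MeasurePreserving T μ μ := by
  refine ⟨hT, ?_⟩
  have := congrArg (Measure.map Prod.snd) h
  rw [Measure.map_map measurable_snd (hV.prodMk hT)] at this
  simpa [Function.comp_def] using this

theorem hasLaw_iterate_of_map_prodMk_eq [IsProbabilityMeasure ρ] [IsProbabilityMeasure μ]
    (hV : Measurable V) (hT : Measurable T)
    (h : μ.map (fun z => (V z, T z)) = ρ.prod μ) (n : ℕ) :
    HasLaw (fun z => V (T^[n] z)) ρ μ := by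
  have hV0 : μ.map V = ρ := by
    have := congrArg (Measure.map Prod.fst) h
    rw [Measure.map_map measurable_fst (hV.prodMk hT)] at this
    simpa [Function.comp_def] using this
  refine ⟨(hV.comp (hT.iterate n)).aemeasurable, ?_⟩
  have hTn := (measurePreserving_of_map_prodMk_eq hV hT h).iterate n
  change μ.map (V ∘ T^[n]) = ρ
  rw [← Measure.map_map hV (hT.iterate n), hTn.map_eq, hV0]

/-- If one step of a dynamical system yields an output `V` with law `ρ` which is independent of the
new state `T`, and the law `μ` of the state is invariant, then the outputs are independent. -/
theorem iIndepFun_iterate_of_map_prodMk_eq [IsProbabilityMeasure ρ] [IsProbabilityMeasure μ]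
    (hV : Measurable V) (hT : Measurable T)
    (h : μ.map (fun z => (V z, T z)) = ρ.prod μ) :
    iIndepFun (fun n z => V (T^[n] z)) μ := by
  -- Peel off the first output: the remaining constraints form an event for the new state, which
  -- again has law `μ`. This is why `B` is quantified inside the induction.
  have key : ∀ (n : ℕ) (B : ℕ → Set F), (∀ k, MeasurableSet (B k)) →
      μ {z | ∀ k < n, V (T^[k] z) ∈ B k} = ∏ k ∈ Finset.range n, ρ (B k) := by
    intro n
    induction n with
    | zero => intro B _; simp
    | succ n ih =>
      intro B hB
      have hm : MeasurableSet {z | ∀ k < n, V (T^[k] z) ∈ B (k + 1)} := by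
        simp only [Set.ofPred_forall]
        exact MeasurableSet.iInter fun k => MeasurableSet.iInter fun _ =>
          (hV.comp (hT.iterate k)) (hB _)
      have : {z | ∀ k < n + 1, V (T^[k] z) ∈ B k} = (fun z => (V z, T z)) ⁻¹'
          (B 0 ×ˢ {z | ∀ k < n, V (T^[k] z) ∈ B (k + 1)}) := by
        ext z
        simp only [Set.mem_ofPred_eq, Set.mem_preimage, Set.mem_prod]
        constructor
        · intro hz
          exact ⟨hz 0 (by omega), fun k hk => by simpa using hz (k + 1) (by omega)⟩
        · rintro ⟨h0, h1⟩ k hk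
          cases k with
          | zero => exact h0
          | succ k => simpa using h1 k (by omega)
      rw [this, ← Measure.map_apply (hV.prodMk hT) ((hB 0).prod hm), h, Measure.prod_prod,
        ih (fun k => B (k + 1)) fun k => hB _, Finset.prod_range_succ', mul_comm]
  rw [iIndepFun_iff_measure_inter_preimage_eq_mul]
  intro S sets hsets
  obtain ⟨n, hn⟩ : ∃ n, S ⊆ Finset.range n := S.exists_nat_subset_range
  classical
  let B : ℕ → Set F := fun k => if k ∈ S then sets k else Set.univ
  have hB : ∀ k, MeasurableSet (B k) := by
    intro k; by_cases hk : k ∈ S <;> simp [B, hk, hsets]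
  have hset : (⋂ k ∈ S, (fun z => V (T^[k] z)) ⁻¹' sets k) =
      {z | ∀ k < n, V (T^[k] z) ∈ B k} := by
    ext z
    simp only [Set.mem_iInter, Set.mem_preimage, Set.mem_ofPred_eq, B]
    constructor
    · intro hz k _
      by_cases hk : k ∈ S <;> simp [hk, hz]
    · intro hz k hk
      simpa [hk] using hz k (Finset.mem_range.1 (hn hk))
  rw [hset, key n B hB, ← Finset.prod_subset hn]
  · refine Finset.prod_congr rfl fun k hk => ?_
    have := hasLaw_iterate_of_map_prodMk_eq hV hT h k
    simp only [B, hk, if_true]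
    rw [← this.map_eq]
    exact Measure.map_apply (hV.comp (hT.iterate k)) (hsets k hk)
  · intro k _ hk
    simp [B, hk]

end Iterate

/-! ### The exponential law. -/

section Exponential

theorem lintegral_expMeasure {r : ℝ} {f : ℝ → ENNReal} (hf : Measurable f) :
    ∫⁻ x, f x ∂(expMeasure r) =
      ∫⁻ x in Set.Ioi 0, ENNReal.ofReal (r * Real.exp (-(r * x))) * f x := by
  have h : expMeasure r = volume.withDensity (exponentialPDF r) := rfl
  have hm : Measurable (exponentialPDF r) := (measurable_exponentialPDFReal r).ennreal_ofReal
  rw [h, lintegral_withDensity_eq_lintegral_mul _ hm hf, ← lintegral_indicator measurableSet_Ioi]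
  refine lintegral_congr_ae ?_
  have h0 : ∀ᵐ x : ℝ, x ≠ 0 := by simp [ae_iff]
  filter_upwards [h0] with x hx
  rcases lt_or_gt_of_ne hx with h | h
  · simp [exponentialPDF_of_neg h, h.le]
  · simp [exponentialPDF_of_nonneg h.le, h]

theorem ae_pos_expMeasure (r : ℝ) : ∀ᵐ x ∂(expMeasure r), 0 < x := by
  rw [ae_iff]
  have hm : MeasurableSet {x : ℝ | ¬ 0 < x} := by
    simp only [not_lt]; exact measurableSet_Iic
  rw [← lintegral_indicator_one hm, lintegral_expMeasure (measurable_one.indicator hm)]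
  rw [setLIntegral_congr_fun (g := fun _ => 0) measurableSet_Ioi]
  · simp
  · intro x hx
    have : 0 < x := hx
    simp [this]

/-- Memorylessness of the exponential law. -/
theorem expMeasure_memoryless {r w : ℝ} (hw : 0 ≤ w) {B : Set ℝ} (hB : MeasurableSet B) :
    expMeasure r {x | w < x ∧ x - w ∈ B} =
      ENNReal.ofReal (Real.exp (-(r * w))) * expMeasure r B := by
  have hm : MeasurableSet {x : ℝ | w < x ∧ x - w ∈ B} :=
    measurableSet_Ioi.inter ((measurable_id.sub_const w) hB)
  rw [← lintegral_indicator_one hm, lintegral_expMeasure (measurable_one.indicator hm),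
    ← lintegral_indicator_one hB, lintegral_expMeasure (measurable_one.indicator hB),
    ← lintegral_const_mul' _ _ ENNReal.ofReal_ne_top,
    ← lintegral_indicator measurableSet_Ioi, ← lintegral_indicator measurableSet_Ioi,
    ← lintegral_add_right_eq_self _ w]
  refine lintegral_congr fun x => ?_
  by_cases hx : 0 < x
  · have h1 : x + w ∈ Set.Ioi (0 : ℝ) := by simp; linarith
    have h2 : x ∈ Set.Ioi (0 : ℝ) := hx
    rw [Set.indicator_of_mem h1, Set.indicator_of_mem h2]
    by_cases hxB : x ∈ B
    · have h3 : x + w ∈ {x : ℝ | w < x ∧ x - w ∈ B} := by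
        refine ⟨by linarith, by simpa using hxB⟩
      rw [Set.indicator_of_mem h3, Set.indicator_of_mem hxB]
      simp only [Pi.one_apply, mul_one]
      rw [← ENNReal.ofReal_mul (Real.exp_pos _).le]
      congr 1
      rw [mul_left_comm, ← Real.exp_add]
      congr 2; ring
    · have h3 : x + w ∉ {x : ℝ | w < x ∧ x - w ∈ B} := by
        rintro ⟨_, h⟩; exact hxB (by simpa using h)
      rw [Set.indicator_of_notMem h3, Set.indicator_of_notMem hxB]
      simp
  · have h2 : x ∉ Set.Ioi (0 : ℝ) := hx
    have h3 : x + w ∉ {x : ℝ | w < x ∧ x - w ∈ B} := by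
      rintro ⟨h, _⟩; linarith
    rw [Set.indicator_of_notMem h2]
    by_cases h1 : x + w ∈ Set.Ioi (0 : ℝ)
    · rw [Set.indicator_of_mem h1, Set.indicator_of_notMem h3, mul_zero]
    · rw [Set.indicator_of_notMem h1]

/-- Exponential tilting: `exp (-b x)` is the chance that competing clocks of total rate `b` stay
silent until `x`. The constant `r / (r + b)` is the probability that the clock of rate `r` rings
first, and the rate `r + b` governs the ringing time given that. -/
theorem lintegral_exp_mul_expMeasure {r b : ℝ} (hr : 0 < r) (hb : 0 ≤ b) {f : ℝ → ENNReal}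
    (hf : Measurable f) :
    ∫⁻ x, f x * ENNReal.ofReal (Real.exp (-(b * x))) ∂(expMeasure r) =
      ENNReal.ofReal (r / (r + b)) * ∫⁻ x, f x ∂(expMeasure (r + b)) := by
  rw [lintegral_expMeasure (by fun_prop), lintegral_expMeasure hf,
    ← lintegral_const_mul' _ _ ENNReal.ofReal_ne_top]
  refine lintegral_congr fun x => ?_
  rw [mul_comm (f x), ← mul_assoc, ← mul_assoc, ← ENNReal.ofReal_mul (by positivity),
    ← ENNReal.ofReal_mul (by positivity)]
  congr 2
  have : r + b ≠ 0 := by positivity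
  rw [mul_assoc, ← Real.exp_add, ← mul_assoc, div_mul_cancel₀ _ this]
  congr 2; ring

theorem expMeasure_Ioi {r s : ℝ} (hr : 0 < r) (hs : 0 ≤ s) :
    expMeasure r (Set.Ioi s) = ENNReal.ofReal (Real.exp (-(r * s))) := by
  have := isProbabilityMeasure_expMeasure hr
  have h := expMeasure_memoryless (r := r) hs MeasurableSet.univ
  simpa [Set.Ioi] using h

theorem lintegral_pow_expMeasure {r : ℝ} (hr : 0 < r) (n : ℕ) :
    ∫⁻ x, ENNReal.ofReal (x ^ n) ∂(expMeasure r) = ENNReal.ofReal (n.factorial / r ^ n) := by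
  rw [lintegral_expMeasure (by fun_prop)]
  have hG := Real.integral_rpow_mul_exp_neg_mul_Ioi (a := n + 1) (r := r) (by positivity) hr
  have hval : ∫ x in Set.Ioi (0 : ℝ), r * Real.exp (-(r * x)) * x ^ n =
      n.factorial / r ^ n := by
    have : ∀ x : ℝ, r * Real.exp (-(r * x)) * x ^ n =
        r * (x ^ ((n : ℝ) + 1 - 1) * Real.exp (-(r * x))) := by
      intro x; rw [add_sub_cancel_right, Real.rpow_natCast]; ring
    simp_rw [this]
    rw [integral_const_mul, hG, Real.Gamma_nat_eq_factorial,
      show ((n : ℝ) + 1) = ((n + 1 : ℕ) : ℝ) by push_cast; rfl, Real.rpow_natCast, one_div,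
      inv_pow, pow_succ]
    field_simp
  rw [← hval, ofReal_integral_eq_lintegral_ofReal]
  · refine setLIntegral_congr_fun measurableSet_Ioi fun x hx => ?_
    exact (ENNReal.ofReal_mul (by positivity)).symm
  -- Integrability comes for free: the integral of a nonintegrable function is `0` by convention,
  -- but its value is positive.
  · by_contra hn
    rw [integral_undef hn] at hval
    have : (0 : ℝ) < n.factorial / r ^ n := by positivity
    linarith
  · filter_upwards [ae_restrict_mem measurableSet_Ioi] with x hx
    have : (0 : ℝ) < x := hx
    simp only [Pi.zero_apply]; positivity

theorem integrable_pow_expMeasure {r : ℝ} (hr : 0 < r) (n : ℕ) :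
    Integrable (fun x => x ^ n) (expMeasure r) := by
  refine ⟨by fun_prop, ?_⟩
  rw [hasFiniteIntegral_iff_ofReal, lintegral_pow_expMeasure hr]
  · exact ENNReal.ofReal_lt_top
  · filter_upwards [ae_pos_expMeasure r] with x hx
    simp only [Pi.zero_apply]; positivity

theorem integral_pow_expMeasure {r : ℝ} (hr : 0 < r) (n : ℕ) :
    ∫ x, x ^ n ∂(expMeasure r) = n.factorial / r ^ n := by
  rw [integral_eq_lintegral_of_nonneg_ae, lintegral_pow_expMeasure hr,
    ENNReal.toReal_ofReal (by positivity)]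
  · filter_upwards [ae_pos_expMeasure r] with x hx
    simp only [Pi.zero_apply]; positivity
  · fun_prop

/-- The mean residual exponential time after `s` on the event that it exceeds `s`. -/
theorem integral_residual_expMeasure {r s : ℝ} (hr : 0 < r) (hs : 0 ≤ s) :
    ∫ w, (if s < w then w - s else 0) ∂(expMeasure r) = Real.exp (-(r * s)) / r := by
  -- Memorylessness as an identity of measures: the residual time, restricted to survival past `s`,
  -- is a multiple of the original law.
  have hmap : ((expMeasure r).restrict (Set.Ioi s)).map (fun x => x - s) =
      ENNReal.ofReal (Real.exp (-(r * s))) • expMeasure r := by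
    ext B hB
    rw [Measure.map_apply (by fun_prop) hB,
      Measure.restrict_apply (measurableSet_preimage (by fun_prop) hB), Measure.smul_apply,
      smul_eq_mul, ← expMeasure_memoryless hs hB]
    congr 1; ext x; simp [and_comm]
  have h1 : ∫ w, (if s < w then w - s else 0) ∂(expMeasure r) =
      ∫ w in Set.Ioi s, (w - s) ∂(expMeasure r) := by
    rw [← integral_indicator measurableSet_Ioi]
    rfl
  have h2 := integral_map (μ := (expMeasure r).restrict (Set.Ioi s)) (φ := fun x => x - s)
    (f := fun y : ℝ => y) (by fun_prop) (by fun_prop)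
  rw [h1, ← h2, hmap, integral_smul_measure, ENNReal.toReal_ofReal (Real.exp_pos _).le]
  have := integral_pow_expMeasure hr 1
  simp only [pow_one, Nat.factorial_one, Nat.cast_one] at this
  rw [this, smul_eq_mul]
  ring

end Exponential

/-! ### One step of the merged arrival process -/

section Step

variable {M : ℕ}

/-- Index set of a sample path: interarrival times on the left, service times on the right. -/
abbrev Idx (M : ℕ) : Type := (Fin M × ℕ) ⊕ (Fin M × ℕ)

/-- The laws of the coordinates of a sample path. -/
def pathLaw (rate : Fin M → ℝ) (ν : Measure ℝ) : Idx M → Measure ℝ :=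
  Sum.elim (fun p => expMeasure (rate p.1)) (fun _ => ν)

/-- The law of a sample path. -/
def pathMeasure (rate : Fin M → ℝ) (ν : Measure ℝ) : Measure (Idx M → ℝ) :=
  Measure.infinitePi (pathLaw rate ν)

theorem isProbabilityMeasure_pathLaw {rate : Fin M → ℝ} (hr : ∀ i, 0 < rate i) (ν : Measure ℝ)
    [IsProbabilityMeasure ν] (a : Idx M) : IsProbabilityMeasure (pathLaw rate ν a) := by
  rcases a with p | p
  · exact isProbabilityMeasure_expMeasure (hr p.1)
  · assumption

theorem isProbabilityMeasure_pathMeasure {rate : Fin M → ℝ} (hr : ∀ i, 0 < rate i)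
    (ν : Measure ℝ) [IsProbabilityMeasure ν] : IsProbabilityMeasure (pathMeasure rate ν) := by
  have := isProbabilityMeasure_pathLaw hr ν
  unfold pathMeasure; infer_instance

/-- The indices left after the first update of stream `j` has been removed. -/
def skip (j : Fin M) : Idx M → Idx M
  | .inl (k, n) => .inl (k, if k = j then n + 1 else n)
  | .inr (k, n) => .inr (k, if k = j then n + 1 else n)

theorem skip_injective (j : Fin M) : Function.Injective (skip j) := by
  rintro (⟨k, n⟩ | ⟨k, n⟩) (⟨k', n'⟩ | ⟨k', n'⟩) h <;> simp only [skip, Sum.inl.injEq,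
    Sum.inr.injEq, Prod.mk.injEq, reduceCtorEq] at h ⊢
  all_goals
    obtain ⟨rfl, h⟩ := h
    refine ⟨rfl, ?_⟩
    split_ifs at h <;> omega

/-- The indices of the first interarrival times of the streams other than `j`. -/
def firstOthers (j : Fin M) : Finset (Idx M) :=
  (Finset.univ.erase j).map ⟨fun k => .inl (k, 0), fun a b h => by simpa using h⟩

@[simp]
theorem inl_mem_firstOthers {j k : Fin M} {n : ℕ} :
    (Sum.inl (k, n) : Idx M) ∈ firstOthers j ↔ k ≠ j ∧ n = 0 := by
  rw [firstOthers, Finset.mem_map]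
  constructor
  · rintro ⟨a, ha, h⟩
    obtain ⟨rfl, rfl⟩ : a = k ∧ 0 = n := by
      have h' : (Sum.inl (a, 0) : Idx M) = Sum.inl (k, n) := h
      simpa using h'
    exact ⟨Finset.ne_of_mem_erase ha, rfl⟩
  · rintro ⟨hk, rfl⟩
    exact ⟨k, by simpa using hk, rfl⟩

@[simp]
theorem inr_notMem_firstOthers {j : Fin M} {p : Fin M × ℕ} :
    (Sum.inr p : Idx M) ∉ firstOthers j := by
  simp [firstOthers]

/-- Let time `w` elapse for all streams but `j`. -/
def lower (j : Fin M) (w : ℝ) (z : Idx M → ℝ) (a : Idx M) : ℝ :=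
  if a ∈ firstOthers j then z a - w else z a

/-- The state of the system after the first update of stream `j`. -/
def advance (j : Fin M) (z : Idx M → ℝ) : Idx M → ℝ :=
  lower j (z (.inl (j, 0))) fun a => z (skip j a)

/-- Stream `j` generates the first update. -/
def IsFirst (j : Fin M) (z : Idx M → ℝ) : Prop :=
  ∀ a ∈ firstOthers j, z (.inl (j, 0)) < z a

theorem IsFirst.lt {j k : Fin M} {z : Idx M → ℝ} (h : IsFirst j z) (hk : k ≠ j) :
    z (.inl (j, 0)) < z (.inl (k, 0)) :=
  h _ (by simp [hk])

theorem IsFirst.unique {j k : Fin M} {z : Idx M → ℝ} (hj : IsFirst j z) (hk : IsFirst k z) :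
    j = k := by
  by_contra h
  exact lt_asymm (hj.lt (Ne.symm h)) (hk.lt h)

theorem measurable_lower (j : Fin M) :
    Measurable fun p : ℝ × (Idx M → ℝ) => lower j p.1 p.2 := by
  refine measurable_pi_iff.2 fun a => ?_
  unfold lower
  split_ifs <;> fun_prop

theorem measurable_advance (j : Fin M) : Measurable (advance j) := by
  have : Measurable fun z : Idx M → ℝ => (z (.inl (j, 0)), fun a => z (skip j a)) := by fun_prop
  exact (measurable_lower j).comp this

theorem measurableSet_isFirst (j : Fin M) : MeasurableSet {z : Idx M → ℝ | IsFirst j z} := by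
  simp only [IsFirst, Set.ofPred_forall]
  exact MeasurableSet.iInter fun a => MeasurableSet.iInter fun _ =>
    measurableSet_lt (by fun_prop) (by fun_prop)

variable {rate : Fin M → ℝ} {ν : Measure ℝ} [IsProbabilityMeasure ν]

/-- The coordinates removed are disjoint from the range of `skip j`, hence independent of the rest;
renumbering preserves the product law because the coordinates of each kind in a stream share one
law. -/
theorem map_first_skip_pathMeasure (hr : ∀ i, 0 < rate i) (j : Fin M) :
    (pathMeasure rate ν).map
        (fun z => ((z (.inl (j, 0)), z (.inr (j, 0))), fun a => z (skip j a))) =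
      ((expMeasure (rate j)).prod ν).prod (pathMeasure rate ν) := by
  have hp := isProbabilityMeasure_pathLaw hr ν
  have hp' := isProbabilityMeasure_pathMeasure hr ν
  have hind : iIndepFun (fun (a : Idx M) (z : Idx M → ℝ) => z a) (pathMeasure rate ν) :=
    iIndepFun_infinitePi (X := fun _ x => x) (by fun_prop)
  have hI : IndepFun (fun z : Idx M → ℝ => (z (.inl (j, 0)), z (.inr (j, 0))))
      (fun z a => z (skip j a)) (pathMeasure rate ν) := by
    have hd : Disjoint ({.inl (j, 0), .inr (j, 0)} : Set (Idx M)) (Set.range (skip j)) := by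
      rw [Set.disjoint_left]
      rintro a ha ⟨b, rfl⟩
      rcases b with ⟨k, n⟩ | ⟨k, n⟩ <;> simp only [skip, Set.mem_insert_iff, Sum.inl.injEq,
        Sum.inr.injEq, Prod.mk.injEq, reduceCtorEq, Set.mem_singleton_iff, or_false,
        false_or] at ha <;> obtain ⟨rfl, h⟩ := ha <;> simp at h
    have h := indep_iSup_of_disjoint (m := fun a : Idx M => MeasurableSpace.comap
      (fun z : Idx M → ℝ => z a) inferInstance) (fun a => (measurable_pi_apply a).comap_le)
      hind.iIndep hd
    refine indep_of_indep_of_le_left (indep_of_indep_of_le_right h ?_) ?_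
    · simp only [MeasurableSpace.pi, MeasurableSpace.comap_iSup, MeasurableSpace.comap_comp]
      refine iSup_le fun a => ?_
      exact le_biSup (fun a : Idx M => MeasurableSpace.comap
        (fun z : Idx M → ℝ => z a) inferInstance) (Set.mem_range_self a)
    · refine Measurable.comap_le (Measurable.prodMk ?_ ?_)
      · refine Measurable.mono (comap_measurable fun z : Idx M → ℝ => z (.inl (j, 0))) ?_ le_rfl
        exact le_biSup (fun a : Idx M => MeasurableSpace.comap
          (fun z : Idx M → ℝ => z a) inferInstance) (by simp)
      · refine Measurable.mono (comap_measurable fun z : Idx M → ℝ => z (.inr (j, 0))) ?_ le_rfl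
        exact le_biSup (fun a : Idx M => MeasurableSpace.comap
          (fun z : Idx M → ℝ => z a) inferInstance) (by simp)
  have hskip : Measurable fun (z : Idx M → ℝ) a => z (skip j a) := by fun_prop
  rw [(indepFun_iff_map_prod_eq_prod_map_map (by fun_prop) hskip.aemeasurable).1 hI]
  congr 1
  · exact Measure.infinitePi_map_eval_prod (P := pathLaw rate ν) (by simp)
  · unfold pathMeasure
    rw [Measure.map_infinitePi_infinitePi_of_inj (skip_injective j)]
    congr 1
    ext1 a
    rcases a with ⟨k, n⟩ | ⟨k, n⟩ <;> rfl

/-- Joint memorylessness of the first arrivals of the other streams: given that all exceed `w`, the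
residual path is a fresh one. The survival probabilities multiply to the exponential factor. -/
theorem pathMeasure_lower (hr : ∀ i, 0 < rate i) (j : Fin M) {w : ℝ} (hw : 0 ≤ w)
    {B : Set (Idx M → ℝ)} (hB : MeasurableSet B) :
    pathMeasure rate ν {z | (∀ a ∈ firstOthers j, w < z a) ∧ lower j w z ∈ B} =
      ENNReal.ofReal (Real.exp (-((∑ k ∈ Finset.univ.erase j, rate k) * w))) *
        pathMeasure rate ν B := by
  have hp := isProbabilityMeasure_pathLaw hr ν
  set c := ENNReal.ofReal (Real.exp (-((∑ k ∈ Finset.univ.erase j, rate k) * w))) with hc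
  have hc0 : c ≠ 0 := by simp [hc, Real.exp_pos]
  have hct : c ≠ ⊤ := ENNReal.ofReal_ne_top
  have hml : Measurable (lower j w) :=
    (measurable_lower j).comp (measurable_const.prodMk measurable_id)
  have hA : MeasurableSet {z : Idx M → ℝ | ∀ a ∈ firstOthers j, w < z a} := by
    simp only [Set.ofPred_forall]
    exact MeasurableSet.iInter fun a => MeasurableSet.iInter fun _ =>
      measurableSet_lt (by fun_prop) (by fun_prop)
  set m' := ((pathMeasure rate ν).restrict {z | ∀ a ∈ firstOthers j, w < z a}).map (lower j w)
    with hm'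
  have happ : ∀ B, MeasurableSet B → m' B =
      pathMeasure rate ν {z | (∀ a ∈ firstOthers j, w < z a) ∧ lower j w z ∈ B} := by
    intro B hB
    rw [hm', Measure.map_apply hml hB, Measure.restrict_apply (hml hB)]
    congr 1; ext z; simp [and_comm]
  -- The conditional law is identified with the product measure by testing on boxes, where each
  -- coordinate contributes its survival factor and its own mass separately.
  have heq : c⁻¹ • m' = pathMeasure rate ν := by
    refine Measure.eq_infinitePi _ fun s t ht => ?_
    rw [Measure.smul_apply, happ _ (MeasurableSet.pi s.countable_toSet fun a _ => ht a)]
    classical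
    have hset : {z : Idx M → ℝ | (∀ a ∈ firstOthers j, w < z a) ∧ lower j w z ∈ Set.pi s t} =
        Set.pi (↑(s ∪ firstOthers j)) fun a => {x | (a ∈ firstOthers j → w < x) ∧
          (a ∈ s → (if a ∈ firstOthers j then x - w else x) ∈ t a)} := by
      ext z
      simp only [Set.mem_ofPred_eq, Set.mem_pi, lower, Finset.mem_coe, Finset.mem_union]
      constructor
      · rintro ⟨h1, h2⟩ a _
        exact ⟨h1 a, h2 a⟩
      · intro h
        exact ⟨fun a ha => (h a (Or.inr ha)).1 ha, fun a ha => (h a (Or.inl ha)).2 ha⟩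
    have hfac : ∀ a : Idx M, pathLaw rate ν a {x | (a ∈ firstOthers j → w < x) ∧
          (a ∈ s → (if a ∈ firstOthers j then x - w else x) ∈ t a)} =
        (if a ∈ firstOthers j then Sum.elim (fun p : Fin M × ℕ =>
          ENNReal.ofReal (Real.exp (-(rate p.1 * w)))) (fun _ => 1) a else 1) *
        (if a ∈ s then pathLaw rate ν a (t a) else 1) := by
      intro a
      by_cases ha : a ∈ firstOthers j
      · rcases a with p | p
        · have hmem := expMeasure_memoryless (r := rate p.1) hw (ht (.inl p))
          have huniv := expMeasure_Ioi (hr p.1) hw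
          by_cases has : Sum.inl p ∈ s
          · simpa [ha, has, pathLaw] using hmem
          · simpa [ha, has, pathLaw, Set.Ioi] using huniv
        · simp at ha
      · by_cases has : a ∈ s <;> simp [ha, has]
    have hmeas : ∀ a ∈ s ∪ firstOthers j, MeasurableSet {x | (a ∈ firstOthers j → w < x) ∧
          (a ∈ s → (if a ∈ firstOthers j then x - w else x) ∈ t a)} := by
      intro a _
      by_cases ha : a ∈ firstOthers j <;> by_cases has : a ∈ s <;> simp only [ha, has, if_true,
        if_false, true_imp_iff, false_imp_iff, true_and, and_true]
      · exact measurableSet_Ioi.inter (measurableSet_preimage (f := fun x => x - w)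
          (by fun_prop) (ht a))
      · exact measurableSet_Ioi
      · exact ht a
      · exact MeasurableSet.univ
    rw [hset, pathMeasure, Measure.infinitePi_pi _ hmeas, Finset.prod_congr rfl fun a _ => hfac a,
      Finset.prod_mul_distrib, Finset.prod_ite_mem, Finset.prod_ite_mem,
      Finset.inter_eq_right.2 Finset.subset_union_left,
      Finset.inter_eq_right.2 Finset.subset_union_right]
    have hprod : ∏ a ∈ firstOthers j, Sum.elim (fun p : Fin M × ℕ =>
          ENNReal.ofReal (Real.exp (-(rate p.1 * w)))) (fun _ => 1) a = c := by
      rw [firstOthers, Finset.prod_map, hc, Finset.sum_mul, ← Finset.sum_neg_distrib,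
        Real.exp_sum, ENNReal.ofReal_prod_of_nonneg fun _ _ => (Real.exp_pos _).le]
      rfl
    rw [hprod, smul_eq_mul, ← mul_assoc, ENNReal.inv_mul_cancel hc0 hct, one_mul]
  rw [← happ B hB]
  conv_rhs => rw [← heq]
  rw [Measure.smul_apply, smul_eq_mul, ← mul_assoc, ENNReal.mul_inv_cancel hc0 hct, one_mul]

/-- Condition on the first interarrival `w` of stream `j`: the other streams are silent until `w`
with probability `exp (-b w)` and then leave a fresh state. Tilting the law of `w` by this factor
turns rate `rate j` into the total rate. -/
theorem pathMeasure_isFirst_inter (hr : ∀ i, 0 < rate i) (j : Fin M) {C : Set (ℝ × ℝ)}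
    (hC : MeasurableSet C) {B : Set (Idx M → ℝ)} (hB : MeasurableSet B) :
    pathMeasure rate ν
        {z | IsFirst j z ∧ (z (.inl (j, 0)), z (.inr (j, 0))) ∈ C ∧ advance j z ∈ B} =
      ENNReal.ofReal (rate j / ∑ k, rate k) *
        ((expMeasure (∑ k, rate k)).prod ν) C * pathMeasure rate ν B := by
  have hsum : ∑ k, rate k = rate j + ∑ k ∈ Finset.univ.erase j, rate k :=
    (Finset.add_sum_erase _ _ (Finset.mem_univ j)).symm
  set b := ∑ k ∈ Finset.univ.erase j, rate k with hb
  have hb0 : 0 ≤ b := Finset.sum_nonneg fun k _ => (hr k).le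
  have := isProbabilityMeasure_expMeasure (hr j)
  have : IsProbabilityMeasure (expMeasure (rate j + b)) :=
    isProbabilityMeasure_expMeasure (by linarith [hr j])
  have hp' := isProbabilityMeasure_pathMeasure hr ν
  set Q : Set ((ℝ × ℝ) × (Idx M → ℝ)) :=
    {q | (∀ a ∈ firstOthers j, q.1.1 < q.2 a) ∧ q.1 ∈ C ∧ lower j q.1.1 q.2 ∈ B} with hQ
  have hQm : MeasurableSet Q := by
    have h1 : MeasurableSet {q : (ℝ × ℝ) × (Idx M → ℝ) | ∀ a ∈ firstOthers j, q.1.1 < q.2 a} := by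
      simp only [Set.ofPred_forall]
      exact MeasurableSet.iInter fun a => MeasurableSet.iInter fun _ =>
        measurableSet_lt (by fun_prop) (by fun_prop)
    have h2 : MeasurableSet {q : (ℝ × ℝ) × (Idx M → ℝ) | q.1 ∈ C} := measurable_fst hC
    have h3 : MeasurableSet {q : (ℝ × ℝ) × (Idx M → ℝ) | lower j q.1.1 q.2 ∈ B} := by
      have : Measurable fun q : (ℝ × ℝ) × (Idx M → ℝ) => lower j q.1.1 q.2 :=
        (measurable_lower j).comp (f := fun q : (ℝ × ℝ) × (Idx M → ℝ) => (q.1.1, q.2))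
          (by fun_prop)
      exact this hB
    exact h1.inter (h2.inter h3)
  -- The coordinates in `firstOthers j` are fixed by `skip j`, so the event can be read off the pair
  -- and the skipped path, which are independent.
  have hset : {z | IsFirst j z ∧ (z (.inl (j, 0)), z (.inr (j, 0))) ∈ C ∧ advance j z ∈ B} =
      (fun z : Idx M → ℝ => ((z (.inl (j, 0)), z (.inr (j, 0))), fun a => z (skip j a))) ⁻¹' Q := by
    ext z
    have hskip : ∀ a ∈ firstOthers j, z (skip j a) = z a := by
      rintro (⟨k, n⟩ | p) ha
      · simp only [inl_mem_firstOthers] at ha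
        simp [skip, ha.1]
      · simp at ha
    have : (∀ a ∈ firstOthers j, z (.inl (j, 0)) < z (skip j a)) ↔ IsFirst j z :=
      forall₂_congr fun a ha => by rw [hskip a ha]
    simp only [hQ, Set.mem_preimage, Set.mem_ofPred_eq, this, advance]
  rw [hset, ← Measure.map_apply (by fun_prop) hQm, map_first_skip_pathMeasure hr j,
    Measure.prod_apply hQm]
  have hfib : ∀ᵐ q : ℝ × ℝ ∂((expMeasure (rate j)).prod ν),
      pathMeasure rate ν (Prod.mk q ⁻¹' Q) =
        C.indicator 1 q * ENNReal.ofReal (Real.exp (-(b * q.1))) * pathMeasure rate ν B := by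
    have hpos : ∀ᵐ q : ℝ × ℝ ∂((expMeasure (rate j)).prod ν), 0 < q.1 :=
      Measure.quasiMeasurePreserving_fst.ae (ae_pos_expMeasure (rate j))
    filter_upwards [hpos] with q hq
    by_cases hqC : q ∈ C
    · rw [Set.indicator_of_mem hqC, Pi.one_apply, one_mul, ← pathMeasure_lower hr j hq.le hB]
      congr 1; ext z; simp [hQ, hqC]
    · rw [Set.indicator_of_notMem hqC, zero_mul, zero_mul]
      convert measure_empty (μ := pathMeasure rate ν)
      ext z; simp [hQ, hqC]
  have hCm : Measurable (C.indicator (1 : ℝ × ℝ → ENNReal)) := measurable_one.indicator hC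
  rw [lintegral_congr_ae hfib, lintegral_mul_const _ (by fun_prop),
    lintegral_prod_symm _ (by fun_prop)]
  congr 1
  have htilt : ∀ y : ℝ, ∫⁻ x, C.indicator 1 (x, y) * ENNReal.ofReal (Real.exp (-(b * x)))
      ∂(expMeasure (rate j)) = ENNReal.ofReal (rate j / (rate j + b)) *
        ∫⁻ x, C.indicator 1 (x, y) ∂(expMeasure (rate j + b)) := fun y =>
    lintegral_exp_mul_expMeasure (hr j) hb0 (hCm.comp (by fun_prop))
  simp_rw [htilt]
  rw [lintegral_const_mul' _ _ ENNReal.ofReal_ne_top, hsum,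
    ← lintegral_prod_symm _ (by fun_prop), lintegral_indicator_one hC]

/-- The stream which generates the first update (`i` if there is none). -/
def nextStream (i : Fin M) (z : Idx M → ℝ) : Fin M :=
  open Classical in if h : ∃ j, IsFirst j z then h.choose else i

theorem nextStream_eq (i : Fin M) {j : Fin M} {z : Idx M → ℝ} (h : IsFirst j z) :
    nextStream i z = j := by
  have hex : ∃ j, IsFirst j z := ⟨j, h⟩
  rw [nextStream, dif_pos hex]
  exact hex.choose_spec.unique h

@[fun_prop]
theorem measurable_nextStream (i : Fin M) : Measurable (nextStream i) := by
  refine measurable_to_countable' fun j => ?_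
  have hex : MeasurableSet {z : Idx M → ℝ | ∃ j, IsFirst j z} := by
    simp only [Set.ofPred_exists]
    exact MeasurableSet.iUnion measurableSet_isFirst
  have : nextStream i ⁻¹' {j} =
      {z | IsFirst j z} ∪ ({z | ∃ j, IsFirst j z}ᶜ ∩ {_z | i = j}) := by
    ext z
    simp only [Set.mem_preimage, Set.mem_singleton_iff, Set.mem_union, Set.mem_inter_iff,
      Set.mem_compl_iff, Set.mem_ofPred_eq]
    by_cases h : ∃ k, IsFirst k z
    · obtain ⟨k, hk⟩ := h
      rw [nextStream_eq i hk]
      constructor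
      · rintro rfl; exact Or.inl hk
      · rintro (h | h)
        · exact hk.unique h
        · exact absurd ⟨k, hk⟩ h.1
    · have : ¬ IsFirst j z := fun h' => h ⟨j, h'⟩
      simp [nextStream, h, this]
  rw [this]
  exact (measurableSet_isFirst j).union (hex.compl.inter (MeasurableSet.const _))

/-- The time until the first update. -/
def nextWait (i : Fin M) (z : Idx M → ℝ) : ℝ := z (.inl (nextStream i z, 0))

/-- The service time of the first update. -/
def nextService (i : Fin M) (z : Idx M → ℝ) : ℝ := z (.inr (nextStream i z, 0))

/-- The state of the system after the first update. -/
def nextState (i : Fin M) (z : Idx M → ℝ) : Idx M → ℝ := advance (nextStream i z) z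

@[fun_prop]
theorem measurable_nextWait (i : Fin M) : Measurable (nextWait i) := by
  have h : Measurable fun p : (Idx M → ℝ) × Fin M => p.1 (.inl (p.2, 0)) :=
    measurable_from_prod_countable_left fun j =>
      measurable_pi_apply (Sum.inl (j, 0) : Idx M)
  exact h.comp (measurable_id.prodMk (measurable_nextStream i))

@[fun_prop]
theorem measurable_nextService (i : Fin M) : Measurable (nextService i) := by
  have h : Measurable fun p : (Idx M → ℝ) × Fin M => p.1 (.inr (p.2, 0)) :=
    measurable_from_prod_countable_left fun j =>
      measurable_pi_apply (Sum.inr (j, 0) : Idx M)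
  exact h.comp (measurable_id.prodMk (measurable_nextStream i))

theorem measurable_nextState (i : Fin M) : Measurable (nextState (M := M) i) := by
  intro B hB
  have : nextState i ⁻¹' B = ⋃ j, (nextStream i ⁻¹' {j} ∩ advance j ⁻¹' B) := by
    ext z
    simp [nextState]
  rw [this]
  exact MeasurableSet.iUnion fun j =>
    (measurable_nextStream i (measurableSet_singleton j)).inter (measurable_advance j hB)

theorem measurable_next (i : Fin M) : Measurable fun z : Idx M → ℝ =>
    ((nextWait i z, (nextStream i z, nextService i z)), nextState i z) :=
  Measurable.prodMk (by fun_prop) (measurable_nextState i)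

/-- The law of the stream of the first update. -/
def streamLaw (rate : Fin M → ℝ) : Measure (Fin M) :=
  ∑ j, ENNReal.ofReal (rate j / ∑ k, rate k) • Measure.dirac j

theorem sum_ofReal_rate_div (hr : ∀ i, 0 < rate i) (i : Fin M) :
    ∑ j, ENNReal.ofReal (rate j / ∑ k, rate k) = 1 := by
  have hpos : 0 < ∑ k, rate k := Finset.sum_pos (fun k _ => hr k) ⟨i, Finset.mem_univ i⟩
  rw [← ENNReal.ofReal_sum_of_nonneg fun j _ => (div_pos (hr j) hpos).le, ← Finset.sum_div,
    div_self hpos.ne', ENNReal.ofReal_one]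

theorem isProbabilityMeasure_streamLaw (hr : ∀ i, 0 < rate i) (i : Fin M) :
    IsProbabilityMeasure (streamLaw rate) := by
  constructor
  simp [streamLaw, sum_ofReal_rate_div hr i]

theorem lintegral_streamLaw (f : Fin M → ENNReal) :
    ∫⁻ j, f j ∂(streamLaw rate) = ∑ j, ENNReal.ofReal (rate j / ∑ k, rate k) * f j := by
  simp [streamLaw]

/-- The disjoint events "stream `j` is first" have probabilities summing to one, so ties are null
without a separate argument. -/
theorem ae_exists_isFirst (hr : ∀ i, 0 < rate i) (i : Fin M) :
    ∀ᵐ z ∂(pathMeasure rate ν), ∃ j, IsFirst j z := by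
  have hp' := isProbabilityMeasure_pathMeasure hr ν
  have hpos : 0 < ∑ k, rate k := Finset.sum_pos (fun k _ => hr k) ⟨i, Finset.mem_univ i⟩
  have := isProbabilityMeasure_expMeasure hpos
  have hU : pathMeasure rate ν (⋃ j, {z | IsFirst j z}) = 1 := by
    rw [measure_iUnion _ measurableSet_isFirst, tsum_fintype, ← sum_ofReal_rate_div hr i]
    · refine Finset.sum_congr rfl fun j _ => ?_
      have := pathMeasure_isFirst_inter (ν := ν) hr j MeasurableSet.univ MeasurableSet.univ
      simpa using this
    · intro j k hjk
      rw [Function.onFun, Set.disjoint_left]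
      exact fun z hj hk => hjk (IsFirst.unique hj hk)
  have h := (mem_ae_iff_prob_eq_one (MeasurableSet.iUnion measurableSet_isFirst)).2 hU
  filter_upwards [h] with z hz
  simpa using hz

/-- The waiting time, the stream and the service time of the first update are independent of each
other and of the state after this update, whose law is that of the initial state. -/
theorem map_next_pathMeasure (hr : ∀ i, 0 < rate i) (i : Fin M) :
    (pathMeasure rate ν).map
        (fun z => ((nextWait i z, (nextStream i z, nextService i z)), nextState i z)) =
      ((expMeasure (∑ k, rate k)).prod ((streamLaw rate).prod ν)).prod (pathMeasure rate ν) := by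
  have hp' := isProbabilityMeasure_pathMeasure hr ν
  have hpos : 0 < ∑ k, rate k := Finset.sum_pos (fun k _ => hr k) ⟨i, Finset.mem_univ i⟩
  have := isProbabilityMeasure_expMeasure hpos
  have := isProbabilityMeasure_streamLaw hr i
  have hmeas := measurable_next (M := M) i
  symm
  refine Measure.prod_eq fun s t hs ht => ?_
  rw [Measure.map_apply hmeas (hs.prod ht)]
  set C : Fin M → Set (ℝ × ℝ) := fun j => {q | (q.1, (j, q.2)) ∈ s} with hCdef
  have hC : ∀ j, MeasurableSet (C j) := fun j =>
    measurableSet_preimage (f := fun q : ℝ × ℝ => (q.1, (j, q.2))) (by fun_prop) hs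
  have hset : ((fun z => ((nextWait i z, (nextStream i z, nextService i z)), nextState i z)) ⁻¹'
      s ×ˢ t : Set (Idx M → ℝ)) =ᵐ[pathMeasure rate ν] ⋃ j, {z | IsFirst j z ∧
        (z (.inl (j, 0)), z (.inr (j, 0))) ∈ C j ∧ advance j z ∈ t} := by
    filter_upwards [ae_exists_isFirst (ν := ν) hr i] with z hz
    obtain ⟨j, hj⟩ := hz
    have hJ := nextStream_eq i hj
    apply propext
    change ((nextWait i z, (nextStream i z, nextService i z)), nextState i z) ∈ s ×ˢ t ↔
      z ∈ ⋃ j, {z | IsFirst j z ∧ (z (.inl (j, 0)), z (.inr (j, 0))) ∈ C j ∧ advance j z ∈ t}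
    simp only [nextWait, nextService, nextState, hJ, Set.mem_prod, Set.mem_iUnion,
      Set.mem_ofPred_eq, hCdef]
    constructor
    · intro h
      exact ⟨j, hj, h.1, h.2⟩
    · rintro ⟨k, hk, h1, h2⟩
      obtain rfl := hj.unique hk
      exact ⟨h1, h2⟩
  rw [measure_congr hset, measure_iUnion, tsum_fintype,
    Finset.sum_congr rfl fun j _ => pathMeasure_isFirst_inter hr j (hC j) ht, ← Finset.sum_mul]
  · congr 1
    rw [Measure.prod_apply hs]
    have h1 : ∀ x : ℝ, ((streamLaw rate).prod ν) (Prod.mk x ⁻¹' s) =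
        ∑ j, ENNReal.ofReal (rate j / ∑ k, rate k) * ν (Prod.mk x ⁻¹' C j) := by
      intro x
      rw [Measure.prod_apply (measurable_prodMk_left hs), lintegral_streamLaw]
      rfl
    simp_rw [h1]
    rw [lintegral_finsetSum]
    · refine Finset.sum_congr rfl fun j _ => ?_
      rw [lintegral_const_mul' _ _ ENNReal.ofReal_ne_top, Measure.prod_apply (hC j)]
    · intro j _
      exact (measurable_measure_prodMk_left (hC j)).const_mul _
  · intro j k hjk
    rw [Function.onFun, Set.disjoint_left]
    exact fun z hj hk => hjk (IsFirst.unique hj.1 hk.1)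
  · intro j
    have h2 : MeasurableSet {z : Idx M → ℝ | (z (.inl (j, 0)), z (.inr (j, 0))) ∈ C j} :=
      measurableSet_preimage (f := fun z : Idx M → ℝ => (z (.inl (j, 0)), z (.inr (j, 0))))
        (by fun_prop) (hC j)
    exact (measurableSet_isFirst j).inter (h2.inter ((measurable_advance j) ht))

/-- The output of a step of the extended chain: stream and service time of an update, and the time
until the next update. -/
def output (i : Fin M) (q : (Fin M × ℝ) × (Idx M → ℝ)) : (Fin M × ℝ) × ℝ :=
  (q.1, nextWait i q.2)

/-- A step of the extended chain, which also records stream and service time of the last update. -/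
def extStep (i : Fin M) (q : (Fin M × ℝ) × (Idx M → ℝ)) : (Fin M × ℝ) × (Idx M → ℝ) :=
  ((nextStream i q.2, nextService i q.2), nextState i q.2)

@[fun_prop]
theorem measurable_output (i : Fin M) : Measurable (output i) := by
  unfold output; fun_prop

theorem measurable_extStep (i : Fin M) : Measurable (extStep i) := by
  exact Measurable.prodMk (by fun_prop) ((measurable_nextState i).comp measurable_snd)

/-- `map_next_pathMeasure` pairs an update with the wait before it, whereas success compares its
service with the wait after it. Keeping the last update in the state shifts the pairing; only
reassociation of products remains. -/
theorem map_output_extStep (hr : ∀ i, 0 < rate i) (i : Fin M) :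
    (((streamLaw rate).prod ν).prod (pathMeasure rate ν)).map
        (fun q => (output i q, extStep i q)) =
      (((streamLaw rate).prod ν).prod (expMeasure (∑ k, rate k))).prod
        (((streamLaw rate).prod ν).prod (pathMeasure rate ν)) := by
  have hp' := isProbabilityMeasure_pathMeasure hr ν
  have hpos : 0 < ∑ k, rate k := Finset.sum_pos (fun k _ => hr k) ⟨i, Finset.mem_univ i⟩
  have := isProbabilityMeasure_expMeasure hpos
  have := isProbabilityMeasure_streamLaw hr i
  set θ := (streamLaw rate).prod ν with hθ
  set μ := pathMeasure rate ν with hμ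
  set e := expMeasure (∑ k, rate k) with he
  have h1 : (θ.prod μ).map (Prod.map id fun z =>
      ((nextWait i z, (nextStream i z, nextService i z)), nextState i z)) =
      θ.prod ((e.prod θ).prod μ) := by
    rw [← Measure.map_prod_map _ _ measurable_id (measurable_next i), map_next_pathMeasure hr i,
      Measure.map_id]
  have h2 : MeasurePreserving (MeasurableEquiv.prodAssoc :
      (ℝ × (Fin M × ℝ)) × (Idx M → ℝ) ≃ᵐ _) ((e.prod θ).prod μ) (e.prod (θ.prod μ)) :=
    measurePreserving_prodAssoc e θ μ
  have h3 : MeasurePreserving (MeasurableEquiv.prodAssoc :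
      ((Fin M × ℝ) × ℝ) × ((Fin M × ℝ) × (Idx M → ℝ)) ≃ᵐ _)
      ((θ.prod e).prod (θ.prod μ)) (θ.prod (e.prod (θ.prod μ))) :=
    measurePreserving_prodAssoc θ e (θ.prod μ)
  have h4 := ((MeasurePreserving.id θ).prod h2)
  have h5 := (h3.symm).comp h4
  rw [← h5.map_eq, ← h1, Measure.map_map h5.measurable (measurable_id.prodMap (measurable_next i))]
  rfl

end Step

/-! ### Long-run averages of the merged process -/

section Averages

variable {M : ℕ}

/-- Indicator of the success of an update of stream `i`, from stream and service time of the update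
and the time until the next update. -/
def succInd (i : Fin M) (v : (Fin M × ℝ) × ℝ) : ℝ :=
  if v.1.1 = i ∧ v.1.2 < v.2 then 1 else 0

/-- The part of the time between an update and the next one during which the monitor has not
received a new update of stream `i`. -/
def staleTime (i : Fin M) (v : (Fin M × ℝ) × ℝ) : ℝ :=
  if v.1.1 = i ∧ v.1.2 < v.2 then v.1.2 else v.2

/-- The law of stream and service time of an update and of the time until the next update. -/
def outLaw (rate : Fin M → ℝ) (ν : Measure ℝ) : Measure ((Fin M × ℝ) × ℝ) :=
  ((streamLaw rate).prod ν).prod (expMeasure (∑ k, rate k))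

theorem measurableSet_success (i : Fin M) :
    MeasurableSet {v : (Fin M × ℝ) × ℝ | v.1.1 = i ∧ v.1.2 < v.2} :=
  (measurableSet_preimage (f := fun v : (Fin M × ℝ) × ℝ => v.1.1) (by fun_prop)
    (measurableSet_singleton i)).inter (measurableSet_lt (f := fun v : (Fin M × ℝ) × ℝ => v.1.2)
      (g := fun v => v.2) (by fun_prop) (by fun_prop))

@[fun_prop]
theorem measurable_succInd (i : Fin M) : Measurable (succInd i) :=
  Measurable.ite (measurableSet_success i) measurable_const measurable_const

@[fun_prop]
theorem measurable_staleTime (i : Fin M) : Measurable (staleTime i) :=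
  Measurable.ite (measurableSet_success i) (by fun_prop) (by fun_prop)

theorem succInd_nonneg (i : Fin M) (v) : 0 ≤ succInd i v := by
  unfold succInd; split_ifs <;> norm_num

theorem succInd_le_one (i : Fin M) (v) : succInd i v ≤ 1 := by
  unfold succInd; split_ifs <;> norm_num

variable {rate : Fin M → ℝ} {ν : Measure ℝ}

theorem isProbabilityMeasure_outLaw [IsProbabilityMeasure ν] (hr : ∀ i, 0 < rate i) (i : Fin M) :
    IsProbabilityMeasure (outLaw rate ν) := by
  have hpos : 0 < ∑ k, rate k := Finset.sum_pos (fun k _ => hr k) ⟨i, Finset.mem_univ i⟩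
  have := isProbabilityMeasure_expMeasure hpos
  have := isProbabilityMeasure_streamLaw hr i
  unfold outLaw; infer_instance

theorem integral_streamLaw_ite (hr : ∀ i, 0 < rate i) (i : Fin M) :
    ∫ j, (if j = i then (1 : ℝ) else 0) ∂(streamLaw rate) = rate i / ∑ k, rate k := by
  have hpos : 0 < ∑ k, rate k := Finset.sum_pos (fun k _ => hr k) ⟨i, Finset.mem_univ i⟩
  have := isProbabilityMeasure_streamLaw hr i
  rw [integral_eq_lintegral_of_nonneg_ae (ae_of_all _ fun j => by
    simp only [Pi.zero_apply]; split_ifs <;> norm_num) (by fun_prop), lintegral_streamLaw,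
    Finset.sum_eq_single i]
  · simp [(div_pos (hr i) hpos).le]
  · intro j _ hj; simp [hj]
  · simp

theorem ae_outLaw (hr : ∀ i, 0 < rate i) (hν : ∀ᵐ t ∂ν, 0 ≤ t) (i : Fin M) :
    ∀ᵐ v ∂(outLaw rate ν), 0 ≤ v.1.2 ∧ 0 < v.2 := by
  have hpos : 0 < ∑ k, rate k := Finset.sum_pos (fun k _ => hr k) ⟨i, Finset.mem_univ i⟩
  have := isProbabilityMeasure_expMeasure hpos
  have := isProbabilityMeasure_streamLaw hr i
  have h1 : ∀ᵐ v ∂(outLaw rate ν), 0 ≤ v.1.2 :=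
    Measure.quasiMeasurePreserving_fst.ae (Measure.quasiMeasurePreserving_snd.ae hν)
  have h2 : ∀ᵐ v ∂(outLaw rate ν), 0 < v.2 :=
    Measure.quasiMeasurePreserving_snd.ae (ae_pos_expMeasure _)
  filter_upwards [h1, h2] with v h1 h2 using ⟨h1, h2⟩

theorem integrable_wait_pow [IsProbabilityMeasure ν] (hr : ∀ i, 0 < rate i) (i : Fin M) (n : ℕ) :
    Integrable (fun v : (Fin M × ℝ) × ℝ => v.2 ^ n) (outLaw rate ν) := by
  have hpos : 0 < ∑ k, rate k := Finset.sum_pos (fun k _ => hr k) ⟨i, Finset.mem_univ i⟩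
  have := isProbabilityMeasure_expMeasure hpos
  have := isProbabilityMeasure_streamLaw hr i
  exact (integrable_pow_expMeasure hpos n).comp_snd _

theorem integral_wait_pow [IsProbabilityMeasure ν] (hr : ∀ i, 0 < rate i) (i : Fin M) (n : ℕ) :
    ∫ v, v.2 ^ n ∂(outLaw rate ν) = n.factorial / (∑ k, rate k) ^ n := by
  have hpos : 0 < ∑ k, rate k := Finset.sum_pos (fun k _ => hr k) ⟨i, Finset.mem_univ i⟩
  have := isProbabilityMeasure_expMeasure hpos
  have := isProbabilityMeasure_streamLaw hr i
  rw [← integral_pow_expMeasure hpos n]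
  have := integral_prod_mul (μ := (streamLaw rate).prod ν) (ν := expMeasure (∑ k, rate k))
    (fun _ => (1 : ℝ)) (fun w => w ^ n)
  simpa [outLaw] using this

theorem integrable_succInd [IsProbabilityMeasure ν] (hr : ∀ i, 0 < rate i) (i : Fin M) :
    Integrable (succInd i) (outLaw rate ν) := by
  have := isProbabilityMeasure_outLaw (ν := ν) hr i
  refine Integrable.of_bound (by fun_prop) 1 (ae_of_all _ fun v => ?_)
  rw [Real.norm_of_nonneg (succInd_nonneg i v)]
  exact succInd_le_one i v

/-- On a success the service is shorter than the wait. Domination by the exponential wait is why no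
moment of `S` is assumed. -/
theorem ae_abs_staleTime_le (hr : ∀ i, 0 < rate i) (hν : ∀ᵐ t ∂ν, 0 ≤ t) (i : Fin M) :
    ∀ᵐ v ∂(outLaw rate ν), |staleTime i v| ≤ v.2 := by
  filter_upwards [ae_outLaw hr hν i] with v hv
  unfold staleTime
  split_ifs with h
  · rw [abs_of_nonneg hv.1]; exact h.2.le
  · rw [abs_of_pos hv.2]

theorem integrable_service_mul_succInd [IsProbabilityMeasure ν]
    (hr : ∀ i, 0 < rate i) (hν : ∀ᵐ t ∂ν, 0 ≤ t) (i : Fin M) :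
    Integrable (fun v => v.1.2 * succInd i v) (outLaw rate ν) := by
  have h := integrable_wait_pow (ν := ν) hr i 1
  refine h.mono' (by fun_prop) ?_
  filter_upwards [ae_outLaw hr hν i] with v hv
  rw [Real.norm_of_nonneg (mul_nonneg hv.1 (succInd_nonneg i v)), succInd]
  split_ifs with h
  · simpa using h.2.le
  · simpa using hv.2.le

theorem memLp_staleTime [IsProbabilityMeasure ν]
    (hr : ∀ i, 0 < rate i) (hν : ∀ᵐ t ∂ν, 0 ≤ t) (i : Fin M) :
    MemLp (staleTime i) 2 (outLaw rate ν) := by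
  have h : MemLp (fun v : (Fin M × ℝ) × ℝ => v.2) 2 (outLaw rate ν) :=
    (memLp_two_iff_integrable_sq (by fun_prop)).2 (integrable_wait_pow (ν := ν) hr i 2)
  exact h.mono' (by fun_prop) (ae_abs_staleTime_le hr hν i)

/-- Integration of a function of service time and waiting time over the updates of stream `i`. -/
theorem integral_outLaw_stream [IsProbabilityMeasure ν]
    (hr : ∀ i, 0 < rate i) (hν : ∀ᵐ t ∂ν, 0 ≤ t) (i : Fin M)
    {g : (Fin M × ℝ) × ℝ → ℝ} (hg : Integrable g (outLaw rate ν)) {f : ℝ → ℝ → ℝ} {h : ℝ → ℝ}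
    (hgf : ∀ v, g v = if v.1.1 = i then f v.1.2 v.2 else 0)
    (hfh : ∀ s, 0 ≤ s → ∫ w, f s w ∂(expMeasure (∑ k, rate k)) = h s) :
    ∫ v, g v ∂(outLaw rate ν) = rate i / (∑ k, rate k) * ∫ s, h s ∂ν := by
  have hpos : 0 < ∑ k, rate k := Finset.sum_pos (fun k _ => hr k) ⟨i, Finset.mem_univ i⟩
  have := isProbabilityMeasure_expMeasure hpos
  have := isProbabilityMeasure_streamLaw hr i
  unfold outLaw at hg ⊢
  rw [integral_prod _ hg, ← integral_streamLaw_ite hr i,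
    ← integral_prod_mul (fun j => if j = i then (1 : ℝ) else 0) h]
  refine integral_congr_ae ?_
  have h1 : ∀ᵐ q ∂((streamLaw rate).prod ν), 0 ≤ q.2 := Measure.quasiMeasurePreserving_snd.ae hν
  filter_upwards [h1] with q hq
  by_cases hqi : q.1 = i
  · simp [hgf, hqi, hfh _ hq]
  · simp [hgf, hqi]

theorem integral_succInd [IsProbabilityMeasure ν]
    (hr : ∀ i, 0 < rate i) (hν : ∀ᵐ t ∂ν, 0 ≤ t) (i : Fin M) :
    ∫ v, succInd i v ∂(outLaw rate ν) = rate i / (∑ k, rate k) * laplace ν (∑ k, rate k) := by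
  have hpos : 0 < ∑ k, rate k := Finset.sum_pos (fun k _ => hr k) ⟨i, Finset.mem_univ i⟩
  refine integral_outLaw_stream hr hν i (integrable_succInd hr i)
    (f := fun s w => if s < w then 1 else 0) (fun v => ?_) (fun s hs => ?_)
  · unfold succInd; split_ifs <;> simp_all
  · have : (fun w : ℝ => if s < w then (1 : ℝ) else 0) = (Set.Ioi s).indicator 1 := rfl
    rw [this, integral_indicator_one measurableSet_Ioi, Measure.real, expMeasure_Ioi hpos hs,
      ENNReal.toReal_ofReal (Real.exp_pos _).le, neg_mul]

theorem integral_service_mul_succInd [IsProbabilityMeasure ν]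
    (hr : ∀ i, 0 < rate i) (hν : ∀ᵐ t ∂ν, 0 ≤ t) (i : Fin M) :
    ∫ v, v.1.2 * succInd i v ∂(outLaw rate ν) =
      rate i / (∑ k, rate k) * ∫ t, t * Real.exp (-(∑ k, rate k) * t) ∂ν := by
  have hpos : 0 < ∑ k, rate k := Finset.sum_pos (fun k _ => hr k) ⟨i, Finset.mem_univ i⟩
  refine integral_outLaw_stream hr hν i (integrable_service_mul_succInd hr hν i)
    (f := fun s w => s * if s < w then 1 else 0) (fun v => ?_) (fun s hs => ?_)
  · unfold succInd; split_ifs <;> simp_all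
  · have : (fun w : ℝ => if s < w then (1 : ℝ) else 0) = (Set.Ioi s).indicator 1 := rfl
    rw [integral_const_mul, this, integral_indicator_one measurableSet_Ioi, Measure.real,
      expMeasure_Ioi hpos hs, ENNReal.toReal_ofReal (Real.exp_pos _).le, neg_mul]

/-- The complementary time `W - staleTime` is the residual `(W - S)⁺` on updates of stream `i`,
whose mean is `p / λ` by memorylessness. -/
theorem integral_staleTime [IsProbabilityMeasure ν]
    (hr : ∀ i, 0 < rate i) (hν : ∀ᵐ t ∂ν, 0 ≤ t) (i : Fin M) :
    ∫ v, staleTime i v ∂(outLaw rate ν) =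
      (1 - rate i / (∑ k, rate k) * laplace ν (∑ k, rate k)) / ∑ k, rate k := by
  have hpos : 0 < ∑ k, rate k := Finset.sum_pos (fun k _ => hr k) ⟨i, Finset.mem_univ i⟩
  have := isProbabilityMeasure_outLaw (ν := ν) hr i
  have hw : Integrable (fun v : (Fin M × ℝ) × ℝ => v.2) (outLaw rate ν) := by
    simpa using integrable_wait_pow (ν := ν) hr i 1
  have hw1 : ∫ v, v.2 ∂(outLaw rate ν) = 1 / ∑ k, rate k := by
    simpa using integral_wait_pow (ν := ν) hr i 1
  have hs : Integrable (staleTime i) (outLaw rate ν) :=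
    (memLp_staleTime hr hν i).integrable (by norm_num)
  have h := integral_outLaw_stream hr hν i (hw.sub hs)
    (f := fun s w => if s < w then w - s else 0) (h := fun s =>
      Real.exp (-((∑ k, rate k) * s)) / ∑ k, rate k) (fun v => ?_)
    (fun s hs => integral_residual_expMeasure hpos hs)
  · have h' : ∫ v, (v.2 - staleTime i v) ∂(outLaw rate ν) =
        rate i / (∑ k, rate k) * ∫ s, Real.exp (-((∑ k, rate k) * s)) / (∑ k, rate k) ∂ν := h
    rw [integral_sub hw hs, hw1, integral_div] at h'
    simp only [laplace, neg_mul]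
    have : ∫ v, staleTime i v ∂(outLaw rate ν) = 1 / (∑ k, rate k) - rate i / (∑ k, rate k) *
        ((∫ s, Real.exp (-((∑ k, rate k) * s)) ∂ν) / ∑ k, rate k) := by linarith
    rw [this]; ring
  · simp only [Pi.sub_apply, staleTime]; split_ifs <;> simp_all

/-- The age accumulated up to update `n` when the monitor is up to date at update `0`. -/
def accum (i : Fin M) (v : ℕ → (Fin M × ℝ) × ℝ) : ℕ → ℝ
  | 0 => 0
  | n + 1 => (v n).2 + (1 - succInd i (v n)) * accum i v n

/-- A realization of the merged process whose long-run averages take their typical values. -/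
structure Typical (i : Fin M) (lam p q : ℝ) (v : ℕ → (Fin M × ℝ) × ℝ) : Prop where
  service_nonneg : ∀ n, 0 ≤ (v n).1.2
  wait_pos : ∀ n, 0 < (v n).2
  wait : Tendsto (fun N : ℕ => (∑ n ∈ Finset.range N, (v n).2) / N) atTop (𝓝 (1 / lam))
  wait_sq : Tendsto (fun N : ℕ => (∑ n ∈ Finset.range N, (v n).2 ^ 2) / N) atTop
    (𝓝 (2 / lam ^ 2))
  succ : Tendsto (fun N : ℕ => (∑ n ∈ Finset.range N, succInd i (v n)) / N) atTop (𝓝 p)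
  service : Tendsto (fun N : ℕ => (∑ n ∈ Finset.range N, (v n).1.2 * succInd i (v n)) / N) atTop
    (𝓝 q)
  accum_mul : Tendsto (fun N : ℕ => (∑ n ∈ Finset.range N, accum i v n *
    (staleTime i (v n) - (1 - p) / (lam * p) * succInd i (v n))) / N) atTop (𝓝 0)
  accum_div : Tendsto (fun N : ℕ => accum i v N / N) atTop (𝓝 0)

/-! ### Almost sure averages along the independent outputs. -/

section Chain

variable {Ω : Type*} {V : ℕ → Ω → (Fin M × ℝ) × ℝ}

/-- The information contained in the first `n` outputs. -/
abbrev history (V : ℕ → Ω → (Fin M × ℝ) × ℝ) (n : ℕ) : MeasurableSpace Ω :=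
  ⨆ k ∈ Set.Iio n, MeasurableSpace.comap (V k) inferInstance

theorem measurable_history {k n : ℕ} (hkn : k < n) : Measurable[history V n] (V k) :=
  Measurable.mono (comap_measurable (V k))
    (le_biSup (fun k => MeasurableSpace.comap (V k) inferInstance) (Set.mem_Iio.2 hkn)) le_rfl

/-- Predictability: `accum` at `n` reads only outputs before `n`, and is therefore independent of
output `n`. -/
theorem measurable_accum (i : Fin M) {n N : ℕ} (h : n ≤ N) :
    Measurable[history V N] fun ω => accum i (fun k => V k ω) n := by
  induction n with
  | zero => exact measurable_const
  | succ n ih =>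
    have h1 : Measurable[history V N] (V n) := measurable_history h
    have h2 := ih (by omega)
    simp only [accum]
    have h3 : Measurable[history V N] fun ω => succInd i (V n ω) := (measurable_succInd i).comp h1
    exact (measurable_snd.comp h1).add ((measurable_const.sub h3).mul h2)

variable [MeasurableSpace Ω] {P : Measure Ω}

theorem ae_tendsto_average (hV : ∀ n, Measurable (V n)) (hI : iIndepFun V P)
    (hL : ∀ n, HasLaw (V n) (outLaw rate ν) P) {f : (Fin M × ℝ) × ℝ → ℝ} (hf : Measurable f)
    (hfi : Integrable f (outLaw rate ν)) :
    ∀ᵐ ω ∂P, Tendsto (fun N : ℕ => (∑ n ∈ Finset.range N, f (V n ω)) / N) atTop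
      (𝓝 (∫ v, f v ∂(outLaw rate ν))) := by
  have h := strong_law_ae_real (μ := P) (fun n ω => f (V n ω)) ?_ ?_ ?_
  · have h0 : ∫ ω, f (V 0 ω) ∂P = ∫ v, f v ∂(outLaw rate ν) :=
      (hL 0).integral_comp hf.aestronglyMeasurable
    rw [← h0]; exact h
  · have := (hL 0).map_eq ▸ hfi
    exact this.comp_measurable (hV 0)
  · intro m n hmn
    exact (hI.indepFun hmn).comp hf hf
  · intro n
    exact ((hL n).identDistrib (hL 0)).comp hf

theorem history_le (hV : ∀ n, Measurable (V n)) (n : ℕ) :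
    history V n ≤ (inferInstance : MeasurableSpace Ω) :=
  iSup₂_le fun k _ => (hV k).comap_le

theorem indepFun_history (hV : ∀ n, Measurable (V n)) (hI : iIndepFun V P) {n : ℕ} {X : Ω → ℝ}
    (hX : Measurable[history V n] X) {f : (Fin M × ℝ) × ℝ → ℝ} (hf : Measurable f) :
    IndepFun X (fun ω => f (V n ω)) P := by
  have hd : Disjoint (Set.Iio n) ({n} : Set ℕ) := by simp
  have h := indep_iSup_of_disjoint (fun k => (hV k).comap_le) hI.iIndep hd
  refine indep_of_indep_of_le_left (indep_of_indep_of_le_right h ?_) hX.comap_le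
  refine Measurable.comap_le ?_
  refine Measurable.mono (hf.comp (comap_measurable (V n))) ?_ le_rfl
  exact le_biSup (fun k => MeasurableSpace.comap (V k) inferInstance) (Set.mem_singleton n)

theorem memLp_mul_output (hV : ∀ n, Measurable (V n)) (hI : iIndepFun V P)
    (hL : ∀ n, HasLaw (V n) (outLaw rate ν) P) {n : ℕ} {X : Ω → ℝ}
    (hX : Measurable[history V n] X) (hX2 : MemLp X 2 P) {f : (Fin M × ℝ) × ℝ → ℝ}
    (hf : Measurable f) (hf2 : MemLp f 2 (outLaw rate ν)) :
    MemLp (fun ω => X ω * f (V n ω)) 2 P ∧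
      ∫ ω, (X ω * f (V n ω)) ^ 2 ∂P = (∫ ω, X ω ^ 2 ∂P) * ∫ v, f v ^ 2 ∂(outLaw rate ν) := by
  have hXm : Measurable X := hX.mono (history_le hV n) le_rfl
  have hfm : Measurable fun ω => f (V n ω) := hf.comp (hV n)
  have hfV : Integrable (fun ω => f (V n ω) ^ 2) P := by
    have := (hL n).map_eq ▸ hf2.integrable_sq
    exact this.comp_measurable (hV n)
  have hind : IndepFun (fun ω => X ω ^ 2) (fun ω => f (V n ω) ^ 2) P :=
    (indepFun_history hV hI hX hf).comp (φ := fun x : ℝ => x ^ 2) (ψ := fun x : ℝ => x ^ 2)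
      (by fun_prop) (by fun_prop)
  constructor
  · refine (memLp_two_iff_integrable_sq (hXm.mul hfm).aestronglyMeasurable).2 ?_
    simp only [Pi.mul_apply, mul_pow]
    exact hind.integrable_mul hX2.integrable_sq hfV
  · simp_rw [mul_pow]
    rw [hind.integral_fun_mul_eq_mul_integral (hXm.pow_const 2).aestronglyMeasurable
      (hfm.pow_const 2).aestronglyMeasurable]
    congr 1
    exact (hL n).integral_comp (f := fun v => f v ^ 2) (hf.pow_const 2).aestronglyMeasurable

/-- Each step erases the accumulated age with probability `p`, independently of the past. Young's
inequality with weight `p` gives the recursion `E A_{n+1}² ≤ (1 + 1/p) m + (1 + p)(1 - p) E A_n²`, a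
contraction of factor `1 - p²`. -/
theorem memLp_accum [IsProbabilityMeasure ν] (hr : ∀ i, 0 < rate i) (hV : ∀ n, Measurable (V n))
    (hI : iIndepFun V P) (hL : ∀ n, HasLaw (V n) (outLaw rate ν) P) (i : Fin M)
    {p : ℝ} (hp : ∫ v, succInd i v ∂(outLaw rate ν) = p) (hp0 : 0 < p) :
    ∃ C, ∀ n, MemLp (fun ω => accum i (fun k => V k ω) n) 2 P ∧
      ∫ ω, accum i (fun k => V k ω) n ^ 2 ∂P ≤ C := by
  have hO := isProbabilityMeasure_outLaw (ν := ν) hr i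
  set m := ∫ v, v.2 ^ 2 ∂(outLaw rate ν) with hm
  have hm0 : 0 ≤ m := integral_nonneg fun v => sq_nonneg _
  have hp1 : p ≤ 1 := by
    rw [← hp]
    calc _ ≤ ∫ v, (1 : ℝ) ∂(outLaw rate ν) :=
          integral_mono (integrable_succInd hr i) (integrable_const 1) (succInd_le_one i)
      _ = 1 := by simp
  -- This constant is the fixed point of that recursion.
  refine ⟨(1 + 1 / p) * m / p ^ 2, fun n => ?_⟩
  induction n with
  | zero =>
    simp only [accum]
    refine ⟨MemLp.zero', ?_⟩
    simp only [ne_eq, OfNat.ofNat_ne_zero, not_false_eq_true, zero_pow, integral_zero]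
    positivity
  | succ n ih =>
    have hWm : MemLp (fun v : (Fin M × ℝ) × ℝ => v.2) 2 (outLaw rate ν) :=
      (memLp_two_iff_integrable_sq (by fun_prop)).2 (integrable_wait_pow (ν := ν) hr i 2)
    have hW : MemLp (fun ω => (V n ω).2) 2 P := by
      have := (hL n).map_eq ▸ hWm
      exact this.comp_of_map (hV n).aemeasurable
    have hWsq : ∫ ω, (V n ω).2 ^ 2 ∂P = m :=
      (hL n).integral_comp (f := fun v => v.2 ^ 2) (by fun_prop)
    have hfail : MemLp (fun v => 1 - succInd i v) 2 (outLaw rate ν) := by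
      refine MemLp.of_bound (by fun_prop) 1 (ae_of_all _ fun v => ?_)
      rw [Real.norm_of_nonneg (by linarith [succInd_le_one i v])]
      linarith [succInd_nonneg i v]
    have hfsq : ∫ v, (1 - succInd i v) ^ 2 ∂(outLaw rate ν) = 1 - p := by
      have : ∀ v, (1 - succInd i v) ^ 2 = 1 - succInd i v := fun v => by
        unfold succInd; split_ifs <;> norm_num
      simp_rw [this]
      rw [integral_sub (integrable_const 1) (integrable_succInd hr i), hp]
      simp
    obtain ⟨hY, hYsq⟩ := memLp_mul_output hV hI hL (measurable_accum i le_rfl) ih.1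
      (f := fun v => 1 - succInd i v) (by fun_prop) hfail
    have heq : ∀ ω, accum i (fun k => V k ω) (n + 1) = (V n ω).2 +
        accum i (fun k => V k ω) n * (1 - succInd i (V n ω)) := fun ω => by
      simp only [accum]; ring
    simp_rw [heq]
    refine ⟨hW.add hY, ?_⟩
    calc _ ≤ ∫ ω, ((1 + 1 / p) * (V n ω).2 ^ 2 + (1 + p) *
          (accum i (fun k => V k ω) n * (1 - succInd i (V n ω))) ^ 2) ∂P := by
          refine integral_mono (hW.add hY).integrable_sq
            ((hW.integrable_sq.const_mul _).add (hY.integrable_sq.const_mul _)) fun ω => ?_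
          generalize (V n ω).2 = a
          generalize accum i (fun k => V k ω) n * (1 - succInd i (V n ω)) = b
          have : (1 + 1 / p) * a ^ 2 + (1 + p) * b ^ 2 - (a + b) ^ 2 = (a - p * b) ^ 2 / p := by
            field_simp; ring
          have h2 : 0 ≤ (a - p * b) ^ 2 / p := by positivity
          change (a + b) ^ 2 ≤ _
          linarith
      _ = (1 + 1 / p) * m + (1 + p) * ((∫ ω, accum i (fun k => V k ω) n ^ 2 ∂P) * (1 - p)) := by
          rw [integral_add (hW.integrable_sq.const_mul _) (hY.integrable_sq.const_mul _),
            integral_const_mul, integral_const_mul, hYsq, hWsq, hfsq]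
      _ ≤ (1 + 1 / p) * m + (1 + p) * (((1 + 1 / p) * m / p ^ 2) * (1 - p)) := by
          have : 0 ≤ 1 - p := by linarith
          gcongr
          exact ih.2
      _ = (1 + 1 / p) * m / p ^ 2 := by field_simp; ring

/-- The merged process is almost surely typical. -/
theorem ae_typical [IsProbabilityMeasure ν]
    (hr : ∀ i, 0 < rate i) (hν : ∀ᵐ t ∂ν, 0 ≤ t) (hV : ∀ n, Measurable (V n))
    (hI : iIndepFun V P) (hL : ∀ n, HasLaw (V n) (outLaw rate ν) P) (i : Fin M) {lam : ℝ}
    (hlam : lam = ∑ k, rate k) (hP : 0 < laplace ν lam) :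
    ∀ᵐ ω ∂P, Typical i lam (rate i / lam * laplace ν lam)
      (rate i / lam * ∫ t, t * Real.exp (-lam * t) ∂ν) (fun n => V n ω) := by
  subst hlam
  have hpos : 0 < ∑ k, rate k := Finset.sum_pos (fun k _ => hr k) ⟨i, Finset.mem_univ i⟩
  have hO := isProbabilityMeasure_outLaw (ν := ν) hr i
  have hp := integral_succInd hr hν i
  have hq := integral_service_mul_succInd hr hν i
  have hs := integral_staleTime hr hν i
  have hp0 : 0 < rate i / (∑ k, rate k) * laplace ν (∑ k, rate k) :=
    mul_pos (div_pos (hr i) hpos) hP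
  set lam := ∑ k, rate k
  set p := rate i / lam * laplace ν lam
  obtain ⟨C, hC⟩ := memLp_accum hr hV hI hL i hp hp0
  have hC0 : 0 ≤ C := (integral_nonneg fun ω => sq_nonneg _).trans (hC 0).2
  have h1 : ∀ᵐ ω ∂P, ∀ n, 0 ≤ (V n ω).1.2 ∧ 0 < (V n ω).2 := by
    refine ae_all_iff.2 fun n => ?_
    exact ae_of_ae_map (hV n).aemeasurable ((hL n).map_eq.symm ▸ ae_outLaw hr hν i)
  have h2 := ae_tendsto_average hV hI hL (f := fun v => v.2 ^ 1) (by fun_prop)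
    (integrable_wait_pow hr i 1)
  have h3 := ae_tendsto_average hV hI hL (f := fun v => v.2 ^ 2) (by fun_prop)
    (integrable_wait_pow hr i 2)
  have h4 := ae_tendsto_average hV hI hL (measurable_succInd i) (integrable_succInd hr i)
  have h5 := ae_tendsto_average hV hI hL (f := fun v => v.1.2 * succInd i v) (by fun_prop)
    (integrable_service_mul_succInd hr hν i)
  -- The coefficient is the ratio of the means of `staleTime` and `succInd`, so `g` is centred.
  set g : (Fin M × ℝ) × ℝ → ℝ := fun v => staleTime i v - (1 - p) / (lam * p) * succInd i v
    with hg
  have hgm : Measurable g := by fun_prop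
  have hsucc2 : MemLp (succInd i) 2 (outLaw rate ν) := by
    refine MemLp.of_bound (by fun_prop) 1 (ae_of_all _ fun v => ?_)
    rw [Real.norm_of_nonneg (succInd_nonneg i v)]
    exact succInd_le_one i v
  have hg2 : MemLp g 2 (outLaw rate ν) :=
    (memLp_staleTime hr hν i).sub (hsucc2.const_mul _)
  have hg0 : ∫ v, g v ∂(outLaw rate ν) = 0 := by
    rw [hg, integral_sub ((memLp_staleTime hr hν i).integrable (by norm_num))
      ((integrable_succInd hr i).const_mul _), integral_const_mul, hs, hp]
    field_simp
    ring
  have hD := fun n => memLp_mul_output hV hI hL (measurable_accum i (le_refl n)) (hC n).1 hgm hg2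
  have h6 : ∀ᵐ ω ∂P, Tendsto (fun N : ℕ => (∑ n ∈ Finset.range N,
      accum i (fun k => V k ω) n * g (V n ω)) / N) atTop (𝓝 0) := by
    refine ae_tendsto_average_of_orthogonal (C := C * ∫ v, g v ^ 2 ∂(outLaw rate ν))
      (fun n => (hD n).1) (fun m n hmn => ?_) (fun n => ?_)
    -- Martingale-difference orthogonality: everything but the last factor `g (V n)` is known before
    -- output `n`, and that factor has mean zero.
    · have hX : Measurable[history V n] fun ω => accum i (fun k => V k ω) m * g (V m ω) *
          accum i (fun k => V k ω) n :=
        ((measurable_accum i hmn.le).mul (hgm.comp (measurable_history hmn))).mul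
          (measurable_accum i le_rfl)
      have hind := indepFun_history hV hI hX hgm
      simp_rw [← mul_assoc]
      rw [hind.integral_fun_mul_eq_mul_integral
        (hX.mono (history_le hV n) le_rfl).aestronglyMeasurable
        (hgm.comp (hV n)).aestronglyMeasurable]
      have : ∫ ω, g (V n ω) ∂P = 0 := by
        rw [← hg0]; exact (hL n).integral_comp hgm.aestronglyMeasurable
      rw [this, mul_zero]
    · rw [(hD n).2]
      exact mul_le_mul_of_nonneg_right (hC n).2 (integral_nonneg fun v => sq_nonneg _)
  have h7 : ∀ᵐ ω ∂P, Tendsto (fun N : ℕ => accum i (fun k => V k ω) N * (N : ℝ)⁻¹)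
      atTop (𝓝 0) := by
    refine ae_tendsto_zero_of_summable_integral_sq (fun n => (hC n).1.mul_const _) ?_
    refine Summable.of_nonneg_of_le (fun n => integral_nonneg fun ω => sq_nonneg _)
      (fun n => ?_) ((Real.summable_nat_pow_inv.2 (one_lt_two)).mul_left C)
    simp_rw [mul_pow]
    rw [integral_mul_const, inv_pow]
    exact mul_le_mul_of_nonneg_right (hC n).2 (by positivity)
  rw [integral_wait_pow hr i] at h2 h3
  rw [hp] at h4
  rw [hq] at h5
  filter_upwards [h1, h2, h3, h4, h5, h6, h7] with ω h1 h2 h3 h4 h5 h6 h7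
  exact ⟨fun n => (h1 n).1, fun n => (h1 n).2, by simpa using h2, by simpa using h3, h4, h5, h6,
    by simpa [div_eq_mul_inv] using h7⟩

end Chain

end Averages

/-! ### Sample path analysis -/

section Path

variable {M : ℕ}

theorem sum_range_nth {p : ℕ → Prop} [DecidablePred p] (hp : {n | p n}.Infinite) (f : ℕ → ℝ)
    (N : ℕ) : ∑ j ∈ Finset.range N, f (Nat.nth p j) =
      ∑ k ∈ Finset.range (Nat.nth p N), if p k then f k else 0 := by
  rw [← Finset.sum_filter]
  refine Finset.sum_nbij (Nat.nth p) (fun j hj => ?_) (fun a _ b _ h => ?_) (fun k hk => ?_)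
    (fun _ _ => rfl)
  · rw [Finset.mem_filter, Finset.mem_range]
    exact ⟨(Nat.nth_strictMono hp) (Finset.mem_range.1 hj), Nat.nth_mem_of_infinite hp j⟩
  · exact (Nat.nth_strictMono hp).injective h
  · simp only [Finset.coe_filter, Finset.mem_range, Set.mem_ofPred_eq] at hk
    refine ⟨Nat.count p k, ?_, Nat.nth_count hk.2⟩
    have : Nat.nth p (Nat.count p k) < Nat.nth p N := by rw [Nat.nth_count hk.2]; exact hk.1
    simpa using (Nat.nth_strictMono hp).lt_iff_lt.1 this

theorem sum_range_succ_nth {p : ℕ → Prop} [DecidablePred p] (hp : {n | p n}.Infinite) (f : ℕ → ℝ)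
    (N : ℕ) : ∑ j ∈ Finset.range (N + 1), f (Nat.nth p j) =
      ∑ k ∈ Finset.range (Nat.nth p N + 1), if p k then f k else 0 := by
  rw [Finset.sum_range_succ, sum_range_nth hp, Finset.sum_range_succ,
    if_pos (Nat.nth_mem_of_infinite hp N)]

/-- Renewal-type argument: the growth rate of a monotone function follows from its values along a
sequence of linear growth. -/
theorem tendsto_div_of_tendsto_div_nat {F : ℝ → ℝ} (hF : MonotoneOn F (Set.Ici 0))
    (hF0 : ∀ t, 0 ≤ t → 0 ≤ F t) {a : ℕ → ℝ} (ha : StrictMono a) (ha0 : 0 < a 0) {A B : ℝ}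
    (hB : 0 < B) (hA : Tendsto (fun n : ℕ => F (a n) / n) atTop (𝓝 A))
    (haB : Tendsto (fun n : ℕ => a n / n) atTop (𝓝 B)) :
    Tendsto (fun t => F t / t) atTop (𝓝 (A / B)) := by
  have hinf : Tendsto a atTop atTop := by
    have h := haB.pos_mul_atTop hB tendsto_natCast_atTop_atTop
    refine h.congr' ?_
    filter_upwards [eventually_ge_atTop 1] with n hn
    have : (n : ℝ) ≠ 0 := by positivity
    field_simp
  have hpos : ∀ n, 0 < a n := fun n => ha0.trans_le (ha.monotone (Nat.zero_le n))
  have hex : ∀ t : ℝ, ∃ n, a 0 ≤ t → a n ≤ t ∧ t < a (n + 1) := by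
    intro t
    by_cases h0 : a 0 ≤ t
    · have hgt : ∃ n, t < a n := (hinf.eventually_gt_atTop t).exists
      classical
      have hfind := Nat.find_spec hgt
      have hne : Nat.find hgt ≠ 0 := fun h => by rw [h] at hfind; linarith
      obtain ⟨n, hn⟩ := Nat.exists_eq_succ_of_ne_zero hne
      refine ⟨n, fun _ => ⟨?_, by rw [hn] at hfind; exact hfind⟩⟩
      exact not_lt.1 (Nat.find_min hgt (by omega))
    · exact ⟨0, fun h => absurd h h0⟩
  choose n hn using hex
  have hninf : Tendsto n atTop atTop := by
    refine tendsto_atTop.2 fun b => ?_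
    filter_upwards [eventually_ge_atTop (a b), eventually_ge_atTop (a 0)] with t ht h0
    have := ha.lt_iff_lt.1 (ht.trans_lt (hn t h0).2)
    omega
  have hratio : Tendsto (fun n : ℕ => ((n + 1 : ℕ) : ℝ) / n) atTop (𝓝 1) := by
    have h : Tendsto (fun n : ℕ => 1 + 1 / (n : ℝ)) atTop (𝓝 (1 + 0)) :=
      tendsto_const_nhds.add tendsto_one_div_atTop_nhds_zero_nat
    rw [add_zero] at h
    refine h.congr' ?_
    filter_upwards [eventually_ge_atTop 1] with n hn
    have : (n : ℝ) ≠ 0 := by positivity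
    push_cast; field_simp
  have hsucc : ∀ {b : ℕ → ℝ} {L : ℝ}, Tendsto (fun n : ℕ => b n / n) atTop (𝓝 L) →
      Tendsto (fun n : ℕ => b (n + 1) / n) atTop (𝓝 L) := by
    intro b L hb
    have h := ((tendsto_add_atTop_iff_nat 1).2 hb).mul hratio
    rw [mul_one] at h
    refine h.congr fun n => ?_
    have : ((n + 1 : ℕ) : ℝ) ≠ 0 := by positivity
    field_simp
  -- For `a n ≤ t < a (n + 1)`, `F t / t` lies between `F (a n) / a (n + 1)` and `F (a (n + 1)) / a
  -- n`; the index shift does not change the limit.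
  have hlow : Tendsto (fun n : ℕ => F (a n) / a (n + 1)) atTop (𝓝 (A / B)) := by
    refine (hA.div (hsucc haB) hB.ne').congr' ?_
    filter_upwards [eventually_ge_atTop 1] with n hn
    have : (n : ℝ) ≠ 0 := by positivity
    exact div_div_div_cancel_right₀ this _ _
  have hup : Tendsto (fun n : ℕ => F (a (n + 1)) / a n) atTop (𝓝 (A / B)) := by
    refine ((hsucc (b := fun n => F (a n)) hA).div haB hB.ne').congr' ?_
    filter_upwards [eventually_ge_atTop 1] with n hn
    have : (n : ℝ) ≠ 0 := by positivity
    exact div_div_div_cancel_right₀ this _ _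
  refine tendsto_of_tendsto_of_tendsto_of_le_of_le' (hlow.comp hninf) (hup.comp hninf) ?_ ?_
  · filter_upwards [eventually_ge_atTop (a 0)] with t ht
    obtain ⟨h1, h2⟩ := hn t ht
    have ht0 : 0 < t := ha0.trans_le ht
    exact div_le_div₀ (hF0 t ht0.le) (hF (hpos _).le ht0.le h1) ht0 h2.le
  · filter_upwards [eventually_ge_atTop (a 0)] with t ht
    obtain ⟨h1, h2⟩ := hn t ht
    have ht0 : 0 < t := ha0.trans_le ht
    exact div_le_div₀ (hF0 _ (hpos _).le) (hF ht0.le (hpos _).le h2.le) (hpos _) h1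

/-- The generation time of update `n` of the merged process. -/
def arrival (w₀ : ℝ) (v : ℕ → (Fin M × ℝ) × ℝ) (n : ℕ) : ℝ :=
  w₀ + ∑ k ∈ Finset.range n, (v k).2

/-- Update `n` of the merged process is a successful update of stream `i`. -/
def Suc (i : Fin M) (v : ℕ → (Fin M × ℝ) × ℝ) (n : ℕ) : Prop :=
  (v n).1.1 = i ∧ (v n).1.2 < (v n).2

instance (i : Fin M) (v : ℕ → (Fin M × ℝ) × ℝ) : DecidablePred (Suc i v) :=
  fun _ => Classical.propDecidable _

/-- The time at which update `n` of the merged process is received if it is successful. -/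
def departure (w₀ : ℝ) (v : ℕ → (Fin M × ℝ) × ℝ) (n : ℕ) : ℝ :=
  arrival w₀ v n + (v n).1.2

/-- The generation time of the last successful update of stream `i` before update `n` of the merged
process. -/
def lastSuc (i : Fin M) (a₀ w₀ : ℝ) (v : ℕ → (Fin M × ℝ) × ℝ) : ℕ → ℝ
  | 0 => -a₀
  | n + 1 => if Suc i v n then arrival w₀ v n else lastSuc i a₀ w₀ v n

/-- The streams of the sample path `(x, s)`, merged: update `n` of the merged process is update
`e n` of the stream `(v n).1.1`; its service time is `(v n).1.2` and `(v n).2` is the time until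
update `n + 1` of the merged process. -/
structure IsMerging (x s : Fin M → ℕ → ℝ) (w₀ : ℝ) (v : ℕ → (Fin M × ℝ) × ℝ) (e : ℕ → ℕ) :
    Prop where
  interarrival_pos : ∀ j n, 0 < x j n
  first_pos : 0 < w₀
  wait_pos : ∀ n, 0 < (v n).2
  service_nonneg : ∀ n, 0 ≤ (v n).1.2
  genTime_eq : ∀ n, genTime x (v n).1.1 (e n) = arrival w₀ v n
  service_eq : ∀ n, s (v n).1.1 (e n) = (v n).1.2
  surj : ∀ j m, ∃ n, (v n).1.1 = j ∧ e n = m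

variable {x s : Fin M → ℕ → ℝ} {w₀ : ℝ} {v : ℕ → (Fin M × ℝ) × ℝ} {e : ℕ → ℕ}

theorem arrival_succ (n : ℕ) : arrival w₀ v (n + 1) = arrival w₀ v n + (v n).2 := by
  rw [arrival, arrival, Finset.sum_range_succ, add_assoc]

theorem Suc.departure_lt {i : Fin M} {n : ℕ} (h : Suc i v n) :
    departure w₀ v n < arrival w₀ v (n + 1) := by
  rw [arrival_succ, departure]; linarith [h.2]

theorem succInd_eq (i : Fin M) (n : ℕ) : succInd i (v n) = if Suc i v n then 1 else 0 := by
  by_cases h : Suc i v n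
  · rw [if_pos h]; exact if_pos h
  · rw [if_neg h]; exact if_neg h

theorem staleTime_eq (i : Fin M) (n : ℕ) :
    staleTime i (v n) = if Suc i v n then (v n).1.2 else (v n).2 := by
  by_cases h : Suc i v n
  · rw [if_pos h]; exact if_pos h
  · rw [if_neg h]; exact if_neg h

theorem genTime_strictMono (hx : ∀ j n, 0 < x j n) (j : Fin M) : StrictMono (genTime x j) :=
  strictMono_nat_of_lt_succ fun n => by
    rw [genTime, genTime, Finset.sum_range_succ _ (n + 1)]
    linarith [hx j (n + 1)]

theorem integral_age_of_const {a₀ : ℝ} (i : Fin M) {a b u : ℝ} (hab : a ≤ b)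
    (h : ∀ t, a < t → t < b → lastGen x s a₀ i t = u) :
    ∫ t in a..b, age x s a₀ i t = (b ^ 2 - a ^ 2) / 2 - u * (b - a) := by
  have h1 : ∫ t in a..b, age x s a₀ i t = ∫ t in a..b, (t - u) := by
    refine intervalIntegral.integral_congr_ae ?_
    have hb : ∀ᵐ t : ℝ, t ≠ b := by simp [ae_iff]
    filter_upwards [hb] with t ht hmem
    rw [Set.uIoc_of_le hab] at hmem
    rw [age, h t hmem.1 (lt_of_le_of_ne hmem.2 ht)]
  rw [h1, intervalIntegral.integral_sub (by simp) (by simp)]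
  simp
  ring

namespace IsMerging

theorem arrival_strictMono (hm : IsMerging x s w₀ v e) : StrictMono (arrival w₀ v) :=
  strictMono_nat_of_lt_succ fun n => by rw [arrival_succ]; linarith [hm.wait_pos n]

theorem arrival_pos (hm : IsMerging x s w₀ v e) (n : ℕ) : 0 < arrival w₀ v n :=
  lt_of_lt_of_le (by simpa [arrival] using hm.first_pos)
    (hm.arrival_strictMono.monotone (Nat.zero_le n))

theorem arrival_le_departure (hm : IsMerging x s w₀ v e) (n : ℕ) :
    arrival w₀ v n ≤ departure w₀ v n := by
  rw [departure]; linarith [hm.service_nonneg n]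

theorem depTime_eq (hm : IsMerging x s w₀ v e) (n : ℕ) :
    depTime x s (v n).1.1 (e n) = departure w₀ v n := by
  rw [depTime, departure, hm.genTime_eq, hm.service_eq]

/-- Generations after update `n` are later merged arrivals, and the earliest of them comes after the
wait `(v n).2`; only that one matters. -/
theorem successful_iff (hm : IsMerging x s w₀ v e) (n : ℕ) :
    Successful x s (v n).1.1 (e n) ↔ (v n).1.2 < (v n).2 := by
  constructor
  · intro h
    have h1 := h (v (n + 1)).1.1 (e (n + 1))
    rw [hm.genTime_eq, hm.genTime_eq, hm.depTime_eq, departure, arrival_succ] at h1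
    have := h1 (by linarith [hm.wait_pos n])
    linarith
  · intro h j m
    obtain ⟨k, rfl, rfl⟩ := hm.surj j m
    rw [hm.genTime_eq, hm.genTime_eq, hm.depTime_eq]
    intro hk
    have hnk : n + 1 ≤ k := hm.arrival_strictMono.lt_iff_lt.1 hk
    have h2 := hm.arrival_strictMono.monotone hnk
    rw [arrival_succ] at h2
    rw [departure]; linarith

theorem received_eq (hm : IsMerging x s w₀ v e) (i : Fin M) (t : ℝ) :
    {g | ∃ n, Successful x s i n ∧ depTime x s i n ≤ t ∧ genTime x i n = g} =
      {g | ∃ n, Suc i v n ∧ departure w₀ v n ≤ t ∧ arrival w₀ v n = g} := by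
  ext g
  constructor
  · rintro ⟨m, h1, h2, h3⟩
    obtain ⟨n, rfl, rfl⟩ := hm.surj i m
    rw [hm.successful_iff] at h1
    rw [hm.depTime_eq] at h2
    rw [hm.genTime_eq] at h3
    exact ⟨n, ⟨rfl, h1⟩, h2, h3⟩
  · rintro ⟨n, ⟨rfl, h1⟩, h2, h3⟩
    refine ⟨e n, (hm.successful_iff n).2 h1, ?_, ?_⟩
    · rwa [hm.depTime_eq]
    · rwa [hm.genTime_eq]

theorem isGreatest_lastSuc (hm : IsMerging x s w₀ v e) {a₀ : ℝ} (ha₀ : 0 ≤ a₀)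
    (i : Fin M) (n : ℕ) :
    IsGreatest (insert (-a₀) {g | ∃ k < n, Suc i v k ∧ arrival w₀ v k = g})
      (lastSuc i a₀ w₀ v n) := by
  induction n with
  | zero => simp [lastSuc, IsGreatest, upperBounds]
  | succ n ih =>
    by_cases h : Suc i v n
    · rw [lastSuc, if_pos h]
      refine ⟨Or.inr ⟨n, by omega, h, rfl⟩, ?_⟩
      rintro g (rfl | ⟨k, hk, _, rfl⟩)
      · linarith [hm.arrival_pos n]
      · exact hm.arrival_strictMono.monotone (by omega)
    · rw [lastSuc, if_neg h]
      refine ⟨?_, ?_⟩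
      · rcases ih.1 with h1 | ⟨k, hk, h1⟩
        · exact Or.inl h1
        · exact Or.inr ⟨k, by omega, h1⟩
      · rintro g (rfl | ⟨k, hk, hs, rfl⟩)
        · exact ih.2 (Or.inl rfl)
        · have : k ≠ n := by rintro rfl; exact h hs
          exact ih.2 (Or.inr ⟨k, by omega, hs, rfl⟩)

/-- The two hypotheses say that the successes received by time `t` are exactly those with merged
index below `n`. -/
theorem lastGen_eq (hm : IsMerging x s w₀ v e) {a₀ : ℝ} (ha₀ : 0 ≤ a₀)
    (i : Fin M) {n : ℕ} {t : ℝ} (h1 : ∀ k < n, Suc i v k → departure w₀ v k ≤ t)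
    (h2 : ∀ k, n ≤ k → Suc i v k → t < departure w₀ v k) :
    lastGen x s a₀ i t = lastSuc i a₀ w₀ v n := by
  rw [lastGen, hm.received_eq i t]
  have : {g | ∃ n, Suc i v n ∧ departure w₀ v n ≤ t ∧ arrival w₀ v n = g} =
      {g | ∃ k < n, Suc i v k ∧ arrival w₀ v k = g} := by
    ext g
    constructor
    · rintro ⟨k, hk, hd, rfl⟩
      refine ⟨k, ?_, hk, rfl⟩
      by_contra hkn
      exact absurd hd (not_le.2 (h2 k (not_lt.1 hkn) hk))
    · rintro ⟨k, hk, hs, rfl⟩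
      exact ⟨k, hs, h1 k hk hs, rfl⟩
  rw [this]
  exact (hm.isGreatest_lastSuc ha₀ i n).csSup_eq

theorem mem_received_le (hm : IsMerging x s w₀ v e) {a₀ : ℝ} (ha₀ : 0 ≤ a₀)
    (i : Fin M) {t g : ℝ} (ht : 0 ≤ t) (hg : g ∈ insert (-a₀)
    {g | ∃ n, Successful x s i n ∧ depTime x s i n ≤ t ∧ genTime x i n = g}) : g ≤ t := by
  rw [hm.received_eq] at hg
  rcases hg with rfl | ⟨n, _, h, rfl⟩
  · linarith
  · exact (hm.arrival_le_departure n).trans h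

theorem lastGen_le (hm : IsMerging x s w₀ v e) {a₀ : ℝ} (ha₀ : 0 ≤ a₀)
    (i : Fin M) {t : ℝ} (ht : 0 ≤ t) : lastGen x s a₀ i t ≤ t :=
  csSup_le (Set.insert_nonempty _ _) fun _ hg => hm.mem_received_le ha₀ i ht hg

theorem lastGen_mono (hm : IsMerging x s w₀ v e) {a₀ : ℝ} (ha₀ : 0 ≤ a₀)
    (i : Fin M) : Monotone (lastGen x s a₀ i) := by
  intro t t' h
  have hsub : ∀ {t t' : ℝ}, t ≤ t' → (insert (-a₀)
      {g | ∃ n, Successful x s i n ∧ depTime x s i n ≤ t ∧ genTime x i n = g} : Set ℝ) ⊆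
      insert (-a₀) {g | ∃ n, Successful x s i n ∧ depTime x s i n ≤ t' ∧ genTime x i n = g} := by
    intro t t' h
    refine Set.insert_subset_insert ?_
    rintro g ⟨n, h1, h2, h3⟩
    exact ⟨n, h1, h2.trans h, h3⟩
  -- For negative `t'` the initial value `-a₀` may exceed `t'`, hence the bound `max 0 t'`.
  refine csSup_le_csSup ⟨max 0 t', fun g hg => ?_⟩ (Set.insert_nonempty _ _) (hsub h)
  exact hm.mem_received_le ha₀ i (le_max_left 0 t') (hsub (le_max_right 0 t') hg)

theorem intervalIntegrable_age (hm : IsMerging x s w₀ v e) {a₀ : ℝ} (ha₀ : 0 ≤ a₀)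
    (i : Fin M) (a b : ℝ) :
    IntervalIntegrable (age x s a₀ i) volume a b :=
  (continuous_id.intervalIntegrable a b).sub (hm.lastGen_mono ha₀ i).intervalIntegrable

theorem age_nonneg (hm : IsMerging x s w₀ v e) {a₀ : ℝ} (ha₀ : 0 ≤ a₀)
    (i : Fin M) {t : ℝ} (ht : 0 ≤ t) : 0 ≤ age x s a₀ i t :=
  sub_nonneg.2 (hm.lastGen_le ha₀ i ht)

/-- The integral of the age between two consecutive updates of the merged process. -/
theorem integral_age_step (hm : IsMerging x s w₀ v e) {a₀ : ℝ} (ha₀ : 0 ≤ a₀)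
    (i : Fin M) (n : ℕ) :
    ∫ t in (arrival w₀ v n)..(arrival w₀ v (n + 1)), age x s a₀ i t =
      (v n).2 ^ 2 / 2 + (arrival w₀ v n - lastSuc i a₀ w₀ v n) * staleTime i (v n) := by
  have hc0 : 0 ≤ staleTime i (v n) := by
    rw [staleTime_eq]; split_ifs
    exacts [hm.service_nonneg n, (hm.wait_pos n).le]
  have hcw : staleTime i (v n) ≤ (v n).2 := by
    rw [staleTime_eq]; split_ifs with h
    exacts [h.2.le, le_rfl]
  have hmono := hm.arrival_strictMono
  -- The only possible reception between the two arrivals is at `b`. Without a success `b` is the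
  -- next arrival and the second piece is degenerate.
  set b := arrival w₀ v n + staleTime i (v n) with hb
  have hb1 : b ≤ arrival w₀ v (n + 1) := by rw [arrival_succ]; linarith
  have hdep : ∀ k, k ≤ n → Suc i v k → departure w₀ v k ≤ b := by
    intro k hk hs
    rcases hk.lt_or_eq with h | rfl
    · have := hmono.monotone (Nat.succ_le_of_lt h)
      linarith [hs.departure_lt (w₀ := w₀)]
    · rw [hb, staleTime_eq, if_pos hs, departure]
  have hlater : ∀ k, n + 1 ≤ k → b ≤ departure w₀ v k := fun k hk =>
    hb1.trans ((hmono.monotone hk).trans (hm.arrival_le_departure k))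
  rw [← intervalIntegral.integral_add_adjacent_intervals
    (hm.intervalIntegrable_age ha₀ i _ b) (hm.intervalIntegrable_age ha₀ i b _),
    integral_age_of_const i (u := lastSuc i a₀ w₀ v n) (by linarith) fun t h1 h2 => ?_,
    integral_age_of_const i (u := lastSuc i a₀ w₀ v (n + 1)) hb1 fun t h1 h2 => ?_]
  · rw [lastSuc, arrival_succ]
    split_ifs with h
    · rw [hb]; ring
    · have : staleTime i (v n) = (v n).2 := by rw [staleTime_eq, if_neg h]
      rw [hb, this]; ring
  · refine hm.lastGen_eq ha₀ i (fun k hk hs => (hdep k (by omega) hs).trans h1.le)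
      fun k hk _ => ?_
    exact h2.trans_le ((hmono.monotone hk).trans (hm.arrival_le_departure k))
  · refine hm.lastGen_eq ha₀ i (fun k hk hs => ?_) fun k hk hs => ?_
    · have := hmono.monotone (Nat.succ_le_of_lt hk)
      linarith [hs.departure_lt (w₀ := w₀)]
    · rcases hk.lt_or_eq with h | rfl
      · exact h2.trans_le (hlater k h)
      · rwa [hb, staleTime_eq, if_pos hs] at h2

theorem integral_age_arrival (hm : IsMerging x s w₀ v e) {a₀ : ℝ} (ha₀ : 0 ≤ a₀)
    (i : Fin M) (n : ℕ) :
    ∫ t in (0 : ℝ)..(arrival w₀ v n), age x s a₀ i t =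
      (∫ t in (0 : ℝ)..(arrival w₀ v 0), age x s a₀ i t) + ∑ k ∈ Finset.range n,
        ((v k).2 ^ 2 / 2 + (arrival w₀ v k - lastSuc i a₀ w₀ v k) * staleTime i (v k)) := by
  induction n with
  | zero => simp
  | succ n ih =>
    rw [Finset.sum_range_succ, ← add_assoc, ← ih, ← hm.integral_age_step ha₀ i n,
      intervalIntegral.integral_add_adjacent_intervals (hm.intervalIntegrable_age ha₀ i _ _)
        (hm.intervalIntegrable_age ha₀ i _ _)]

theorem infinite_successful (hm : IsMerging x s w₀ v e) (i : Fin M)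
    (hinf : {n | Suc i v n}.Infinite) :
    {n | Successful x s i n}.Infinite := by
  refine Set.infinite_of_injOn_mapsTo (f := e) (s := {n | Suc i v n}) ?_ ?_ hinf
  · intro m hm' n hn h
    apply hm.arrival_strictMono.injective
    have h1 := hm.genTime_eq m
    have h2 := hm.genTime_eq n
    rw [hm'.1] at h1
    rw [hn.1, ← h] at h2
    rw [← h1, ← h2]
  · intro n hn
    have := (hm.successful_iff n).2 hn.2
    rwa [hn.1] at this

/-- The position `φ` of the updates of stream `i` in the merged order is increasing and matches
successes with successes, so both enumerations of the successes agree. -/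
theorem recTime_eq (hm : IsMerging x s w₀ v e) (i : Fin M)
    (hinf : {n | Suc i v n}.Infinite) (j : ℕ) :
    recTime x s i j = departure w₀ v (Nat.nth (Suc i v) j) := by
  have hinf' := hm.infinite_successful i hinf
  choose φ hφ1 hφ2 using hm.surj i
  have harr : ∀ m, arrival w₀ v (φ m) = genTime x i m := fun m => by
    have := hm.genTime_eq (φ m)
    rw [hφ1, hφ2] at this
    exact this.symm
  have hφ : StrictMono φ := fun m n hmn => by
    rw [← hm.arrival_strictMono.lt_iff_lt, harr, harr]
    exact genTime_strictMono hm.interarrival_pos i hmn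
  have hiff : ∀ m, Successful x s i m ↔ Suc i v (φ m) := fun m => by
    have := hm.successful_iff (φ m)
    rw [hφ1, hφ2] at this
    rw [this, Suc]
    simp [hφ1]
  have hinj : ∀ {n n'}, (v n).1.1 = (v n').1.1 → e n = e n' → n = n' := by
    intro n n' h1 h2
    apply hm.arrival_strictMono.injective
    rw [← hm.genTime_eq, ← hm.genTime_eq, h1, h2]
  -- Two strictly increasing sequences with the same range coincide.
  have heq : φ ∘ Nat.nth (Successful x s i) = Nat.nth (Suc i v) := by
    refine (StrictMono.range_inj (hφ.comp (Nat.nth_strictMono hinf'))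
      (Nat.nth_strictMono hinf)).1 ?_
    rw [Set.range_comp, Nat.range_nth_of_infinite hinf', Nat.range_nth_of_infinite hinf]
    ext n
    constructor
    · rintro ⟨m, hm', rfl⟩
      exact (hiff m).1 hm'
    · intro hn
      have hn' : φ (e n) = n := hinj (by rw [hφ1, hn.1]) (hφ2 _)
      refine ⟨e n, ?_, hn'⟩
      refine (hiff _).2 ?_
      rw [hn']; exact hn
  rw [recTime, ← heq, Function.comp_apply, ← hm.depTime_eq, hφ1, hφ2]

/-- Just before the departure of the `j`-th success all earlier successes have been received, since
they depart before the next arrival, and no later one has. -/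
theorem peakAge_eq (hm : IsMerging x s w₀ v e) {a₀ : ℝ} (ha₀ : 0 ≤ a₀)
    (i : Fin M) (hinf : {n | Suc i v n}.Infinite) (j : ℕ) :
    peakAge x s a₀ i j = departure w₀ v (Nat.nth (Suc i v) j) -
      lastSuc i a₀ w₀ v (Nat.nth (Suc i v) j) := by
  rw [peakAge, hm.recTime_eq i hinf]
  set m := Nat.nth (Suc i v) j
  have hmono := hm.arrival_strictMono
  refine leftLim_eq_of_tendsto ?_
  have h1 : Tendsto (fun t => t - lastSuc i a₀ w₀ v m) (𝓝[<] departure w₀ v m)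
      (𝓝 (departure w₀ v m - lastSuc i a₀ w₀ v m)) :=
    ((continuous_id.sub continuous_const).tendsto _).mono_left nhdsWithin_le_nhds
  refine h1.congr' ?_
  have h2 : ∀ᶠ t in 𝓝[<] departure w₀ v m, ∀ k ∈ Finset.range m,
      Suc i v k → departure w₀ v k ≤ t := by
    rw [Filter.eventually_all_finset]
    intro k hk
    by_cases hs : Suc i v k
    · have hlt : departure w₀ v k < departure w₀ v m := by
        have := hmono.monotone (Nat.succ_le_of_lt (Finset.mem_range.1 hk))
        linarith [hs.departure_lt (w₀ := w₀), hm.arrival_le_departure m]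
      have := (eventually_ge_nhds hlt).filter_mono
        (nhdsWithin_le_nhds (s := Set.Iio (departure w₀ v m)))
      filter_upwards [this] with t ht _ using ht
    · exact Eventually.of_forall fun t h => absurd h hs
  filter_upwards [h2, self_mem_nhdsWithin] with t ht htm
  rw [age, hm.lastGen_eq ha₀ i (fun k hk => ht k (Finset.mem_range.2 hk)) fun k hk hs => ?_]
  rcases hk.lt_or_eq with h | rfl
  · have hsm : Suc i v m := Nat.nth_mem_of_infinite hinf j
    have := hmono.monotone (Nat.succ_le_of_lt h)
    have htm' : t < departure w₀ v m := htm
    linarith [hsm.departure_lt (w₀ := w₀), hm.arrival_le_departure k]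
  · exact htm

/-- At a success `lastSuc` jumps to the current arrival, so the summand is the service time plus the
increment of `lastSuc`; the increments telescope from `-a₀`. -/
theorem sum_departure_sub {a₀ : ℝ} (i : Fin M) (n : ℕ) :
    ∑ k ∈ Finset.range n, (if Suc i v k then departure w₀ v k - lastSuc i a₀ w₀ v k else 0) =
      (∑ k ∈ Finset.range n, (v k).1.2 * succInd i (v k)) + lastSuc i a₀ w₀ v n + a₀ := by
  induction n with
  | zero => simp [lastSuc]
  | succ n ih =>
    rw [Finset.sum_range_succ, ih, Finset.sum_range_succ, lastSuc, succInd_eq]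
    split_ifs
    · rw [departure]; ring
    · ring

theorem sum_peakAge (hm : IsMerging x s w₀ v e) {a₀ : ℝ} (ha₀ : 0 ≤ a₀)
    (i : Fin M) (hinf : {n | Suc i v n}.Infinite) (N : ℕ) :
    ∑ j ∈ Finset.range (N + 1), peakAge x s a₀ i j =
      (∑ k ∈ Finset.range (Nat.nth (Suc i v) N + 1), (v k).1.2 * succInd i (v k)) +
        arrival w₀ v (Nat.nth (Suc i v) N) + a₀ := by
  rw [Finset.sum_congr rfl fun j _ => hm.peakAge_eq ha₀ i hinf j,
    sum_range_succ_nth hinf (fun k => departure w₀ v k - lastSuc i a₀ w₀ v k), sum_departure_sub,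
    lastSuc, if_pos (Nat.nth_mem_of_infinite hinf N)]

end IsMerging

end Path

/-! ### Limits along a typical path. -/

section Limits

variable {M : ℕ} {x s : Fin M → ℕ → ℝ} {w₀ : ℝ} {v : ℕ → (Fin M × ℝ) × ℝ} {e : ℕ → ℕ}
  {i : Fin M} {lam p q : ℝ}

/-- With finitely many successes the averages of `succInd` would tend to `0` instead of `p`. -/
theorem Typical.infinite_suc (ht : Typical i lam p q v) (hp : 0 < p) :
    {n | Suc i v n}.Infinite := by
  intro hfin
  have h0 : Tendsto (fun n => succInd i (v n)) atTop (𝓝 0) := by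
    refine tendsto_const_nhds.congr' ?_
    have := hfin.eventually_cofinite_notMem
    rw [Nat.cofinite_eq_atTop] at this
    filter_upwards [this] with n hn
    rw [succInd_eq, if_neg hn]
  have h1 := h0.cesaro
  have h2 := ht.succ
  simp_rw [div_eq_inv_mul] at h2
  exact hp.ne' (tendsto_nhds_unique h2 h1)

theorem Typical.tendsto_arrival_div (ht : Typical i lam p q v) (w₀ : ℝ) :
    Tendsto (fun n : ℕ => arrival w₀ v n / n) atTop (𝓝 (1 / lam)) := by
  have h := (tendsto_const_div_atTop_nhds_zero_nat w₀).add ht.wait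
  rw [zero_add] at h
  exact h.congr fun n => by rw [arrival, add_div]

/-- After the first success, the age at an update no longer depends on the initial age. -/
theorem eventually_accum_eq (hinf : {n | Suc i v n}.Infinite) (a₀ w₀ : ℝ) :
    ∀ᶠ n in atTop, arrival w₀ v n - lastSuc i a₀ w₀ v n = accum i v n := by
  obtain ⟨k, hk⟩ := hinf.nonempty
  filter_upwards [eventually_ge_atTop (k + 1)] with n hn
  induction n, hn using Nat.le_induction with
  | base =>
    have hk' : Suc i v k := hk
    rw [lastSuc, if_pos hk', arrival_succ, accum, succInd_eq, if_pos hk']; ring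
  | succ n _ ih =>
    rw [lastSuc, arrival_succ, accum, succInd_eq, ← ih]
    split_ifs <;> ring

/-- Every unit of accumulated age is either erased by a success or still present: `succInd * accum`
is the wait minus the increment of `accum`. -/
theorem sum_succInd_mul_accum (n : ℕ) :
    ∑ k ∈ Finset.range n, accum i v k * succInd i (v k) =
      (∑ k ∈ Finset.range n, (v k).2) - accum i v n := by
  induction n with
  | zero => simp [accum]
  | succ n ih => rw [Finset.sum_range_succ, ih, Finset.sum_range_succ, accum]; ring

/-- Split `staleTime` into its centred part, negligible by `accum_mul`, and a multiple of `succInd`,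
whose sum against `accum` telescopes. -/
theorem Typical.tendsto_accum_mul_staleTime (ht : Typical i lam p q v) :
    Tendsto (fun n : ℕ => (∑ k ∈ Finset.range n, accum i v k * staleTime i (v k)) / n) atTop
      (𝓝 ((1 - p) / (lam * p) * (1 / lam))) := by
  have h := ht.accum_mul.add ((ht.wait.sub ht.accum_div).const_mul ((1 - p) / (lam * p)))
  rw [zero_add, sub_zero] at h
  refine h.congr fun n => ?_
  rw [← sub_div, ← sum_succInd_mul_accum, ← mul_div_assoc, ← add_div, Finset.mul_sum,
    ← Finset.sum_add_distrib]
  congr 1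
  refine Finset.sum_congr rfl fun k _ => ?_
  ring

/-- The average age along the merged arrival times. -/
theorem IsMerging.tendsto_integral_age_div (hm : IsMerging x s w₀ v e) {a₀ : ℝ} (ha₀ : 0 ≤ a₀)
    (ht : Typical i lam p q v) (hlam : 0 < lam) (hp : 0 < p) :
    Tendsto (fun n : ℕ => (∫ t in (0 : ℝ)..(arrival w₀ v n), age x s a₀ i t) / n) atTop
      (𝓝 (1 / (lam ^ 2 * p))) := by
  have hinf := ht.infinite_suc hp
  -- The true age at arrivals and `accum` differ only up to the first success, which the averages
  -- forget.
  have hdiff : Tendsto (fun n : ℕ => (∑ k ∈ Finset.range n,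
      ((arrival w₀ v k - lastSuc i a₀ w₀ v k) - accum i v k) * staleTime i (v k)) / n) atTop
      (𝓝 0) := by
    have h0 : Tendsto (fun k => ((arrival w₀ v k - lastSuc i a₀ w₀ v k) - accum i v k) *
        staleTime i (v k)) atTop (𝓝 0) := by
      refine tendsto_const_nhds.congr' ?_
      filter_upwards [eventually_accum_eq hinf a₀ w₀] with n hn
      rw [hn, sub_self, zero_mul]
    simpa only [div_eq_inv_mul] using h0.cesaro
  have hI := tendsto_const_div_atTop_nhds_zero_nat
    (∫ t in (0 : ℝ)..(arrival w₀ v 0), age x s a₀ i t)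
  have h := hI.add (((ht.wait_sq.const_mul (1 / 2)).add hdiff).add ht.tendsto_accum_mul_staleTime)
  have hlim : 0 + ((1 / 2 * (2 / lam ^ 2) + 0) + (1 - p) / (lam * p) * (1 / lam)) =
      1 / (lam ^ 2 * p) := by
    field_simp
    ring
  rw [hlim] at h
  refine h.congr fun n => ?_
  rw [hm.integral_age_arrival ha₀ i n, ← mul_div_assoc, ← add_div, ← add_div, ← add_div,
    Finset.mul_sum, ← Finset.sum_add_distrib, ← Finset.sum_add_distrib]
  congr 2
  refine Finset.sum_congr rfl fun k _ => ?_
  ring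

theorem IsMerging.tendsto_average_age (hm : IsMerging x s w₀ v e) {a₀ : ℝ} (ha₀ : 0 ≤ a₀)
    (ht : Typical i lam p q v) (hlam : 0 < lam) (hp : 0 < p) :
    Tendsto (fun τ : ℝ => (1 / τ) * ∫ t in (0 : ℝ)..τ, age x s a₀ i t) atTop
      (𝓝 (1 / (lam * p))) := by
  -- The age is nonnegative on `[0, ∞)`, so its integral is monotone and the limit along arrivals
  -- extends to all times.
  have hmono : MonotoneOn (fun τ : ℝ => ∫ t in (0 : ℝ)..τ, age x s a₀ i t) (Set.Ici 0) := by
    intro a ha b hb hab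
    have h1 := intervalIntegral.integral_add_adjacent_intervals
      (hm.intervalIntegrable_age ha₀ i 0 a) (hm.intervalIntegrable_age ha₀ i a b)
    have h2 : 0 ≤ ∫ t in a..b, age x s a₀ i t :=
      intervalIntegral.integral_nonneg hab fun t ht =>
        hm.age_nonneg ha₀ i ((Set.mem_Ici.1 ha).trans ht.1)
    simp only
    linarith
  have h := tendsto_div_of_tendsto_div_nat hmono
    (fun t ht => intervalIntegral.integral_nonneg ht fun r hr => hm.age_nonneg ha₀ i hr.1)
    hm.arrival_strictMono (hm.arrival_pos 0) (one_div_pos.2 hlam)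
    (hm.tendsto_integral_age_div ha₀ ht hlam hp) (ht.tendsto_arrival_div w₀)
  have hlim : 1 / (lam ^ 2 * p) / (1 / lam) = 1 / (lam * p) := by field_simp
  rw [hlim] at h
  exact h.congr fun τ => by rw [div_eq_inv_mul, one_div]

theorem IsMerging.tendsto_average_peakAge (hm : IsMerging x s w₀ v e) {a₀ : ℝ} (ha₀ : 0 ≤ a₀)
    (ht : Typical i lam p q v) (hp : 0 < p) :
    Tendsto (fun N : ℕ => (1 / (N : ℝ)) * ∑ j ∈ Finset.range N, peakAge x s a₀ i j) atTop
      (𝓝 ((q + 1 / lam) / p)) := by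
  have hinf := ht.infinite_suc hp
  -- With `N + 1` peaks the sums end just after the success of index `Nat.nth (Suc i v) N`; the
  -- number of successes up to and including it is `N + 1`, so the average is a ratio of averages
  -- over merged updates.
  rw [← tendsto_add_atTop_iff_nat 1]
  have hnth : Tendsto (Nat.nth (Suc i v)) atTop atTop := (Nat.nth_strictMono hinf).tendsto_atTop
  have hQ := (tendsto_add_atTop_iff_nat 1).2 ht.service
  have hY := (tendsto_add_atTop_iff_nat 1).2 ht.succ
  have hone : Tendsto (fun n : ℕ => (n : ℝ) / ((n + 1 : ℕ) : ℝ)) atTop (𝓝 1) := by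
    simpa using tendsto_natCast_div_add_atTop (1 : ℝ)
  have hA : Tendsto (fun n : ℕ => arrival w₀ v n / ((n + 1 : ℕ) : ℝ)) atTop (𝓝 (1 / lam)) := by
    have h := (ht.tendsto_arrival_div w₀).mul hone
    rw [mul_one] at h
    refine h.congr' ?_
    filter_upwards [eventually_ge_atTop 1] with n hn
    have : (n : ℝ) ≠ 0 := by positivity
    field_simp
  have hc := (tendsto_add_atTop_iff_nat 1).2 (tendsto_const_div_atTop_nhds_zero_nat a₀)
  have h := ((((hQ.add hA).add hc).div hY hp.ne').comp hnth)
  rw [add_zero] at h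
  refine h.congr fun N => ?_
  have hcount : ∑ k ∈ Finset.range (Nat.nth (Suc i v) N + 1), succInd i (v k) =
      ((N + 1 : ℕ) : ℝ) := by
    have := sum_range_succ_nth hinf (fun _ => (1 : ℝ)) N
    simp_rw [succInd_eq]
    rw [← this]
    simp
  have hne : ((Nat.nth (Suc i v) N + 1 : ℕ) : ℝ) ≠ 0 := by positivity
  simp only [Function.comp_apply, Pi.div_apply]
  rw [hm.sum_peakAge ha₀ i hinf, ← add_div, ← add_div, div_div_div_cancel_right₀ hne, hcount,
    div_eq_inv_mul, one_div]

end Limits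

/-! ### Merging the streams -/

section Merge

variable {M : ℕ}

/-- The number of updates of stream `j` among the first `n` updates of the merged process. -/
def streamCount (i : Fin M) (z : Idx M → ℝ) : ℕ → Fin M → ℕ
  | 0, _ => 0
  | n + 1, j => if j = nextStream i ((nextState i)^[n] z) then streamCount i z n j + 1
      else streamCount i z n j

/-- The time of the `n`-th update of the merged process, computed from the successive states. -/
def elapsed (i : Fin M) (z : Idx M → ℝ) (n : ℕ) : ℝ :=
  ∑ k ∈ Finset.range n, nextWait i ((nextState i)^[k] z)

variable (i : Fin M) (z : Idx M → ℝ)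

/-- Invariant of the iteration: for each stream the state holds the residual time to its next
generation, followed by the untouched coordinates, shifted by the number of updates already used. -/
theorem iterate_nextState_eq (n : ℕ) (j : Fin M) :
    ((nextState i)^[n] z (.inl (j, 0)) =
        genTime (fun j n => z (.inl (j, n))) j (streamCount i z n j) - elapsed i z n) ∧
      (∀ m, (nextState i)^[n] z (.inl (j, m + 1)) =
        z (.inl (j, streamCount i z n j + m + 1))) ∧
      ∀ m, (nextState i)^[n] z (.inr (j, m)) = z (.inr (j, streamCount i z n j + m)) := by
  induction n generalizing j with
  | zero => simp [streamCount, elapsed, genTime]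
  | succ n ih =>
    have hel : elapsed i z (n + 1) = elapsed i z n +
        (nextState i)^[n] z (.inl (nextStream i ((nextState i)^[n] z), 0)) := by
      rw [elapsed, Finset.sum_range_succ]; rfl
    rw [Function.iterate_succ_apply', hel]
    set y := (nextState i)^[n] z with hy
    set J := nextStream i y with hJ
    have hst : nextState i y = advance J y := rfl
    have hcnt : streamCount i z (n + 1) j =
        if j = J then streamCount i z n j + 1 else streamCount i z n j := rfl
    obtain ⟨h1, h2, h3⟩ := ih j
    rw [hst, hcnt]
    by_cases hj : j = J
    · subst hj
      refine ⟨?_, fun m => ?_, fun m => ?_⟩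
      · have h20 := h2 0
        simp only [advance, lower, inl_mem_firstOthers, skip, ne_eq, not_true_eq_false, false_and,
          if_false, if_true]
        rw [h20, h1, genTime, genTime, Finset.sum_range_succ _ (streamCount i z n J + 1)]
        simp
      · simp only [advance, lower, inl_mem_firstOthers, skip, ne_eq, not_true_eq_false, false_and,
          if_false, if_true]
        rw [h2 (m + 1)]
        congr 3; omega
      · simp only [advance, lower, inr_notMem_firstOthers, skip, if_false, if_true]
        rw [h3 (m + 1)]
        congr 3; omega
    · refine ⟨?_, fun m => ?_, fun m => ?_⟩
      · simp only [advance, lower, inl_mem_firstOthers, skip, ne_eq, hj, not_false_eq_true,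
          and_self, if_false, if_true]
        rw [h1]; ring
      · simp only [advance, lower, inl_mem_firstOthers, skip, ne_eq, hj, Nat.add_eq_zero_iff,
          one_ne_zero, and_false, if_false]
        exact h2 m
      · simp only [advance, lower, inr_notMem_firstOthers, skip, hj, if_false]
        exact h3 m

/-- The state of the extended chain right after the first update. -/
def initial (i : Fin M) (z : Idx M → ℝ) : (Fin M × ℝ) × (Idx M → ℝ) :=
  ((nextStream i z, nextService i z), nextState i z)

theorem iterate_extStep_initial (n : ℕ) :
    (extStep i)^[n] (initial i z) = ((nextStream i ((nextState i)^[n] z),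
      nextService i ((nextState i)^[n] z)), (nextState i)^[n + 1] z) := by
  induction n with
  | zero => rfl
  | succ n ih =>
    rw [Function.iterate_succ_apply', ih, Function.iterate_succ_apply' _ (n + 1)]
    rfl

theorem arrival_eq_elapsed (n : ℕ) :
    arrival (nextWait i z) (fun n => output i ((extStep i)^[n] (initial i z))) n =
      elapsed i z (n + 1) := by
  rw [arrival, elapsed, Finset.sum_range_succ', add_comm]
  simp only [iterate_extStep_initial, output]
  rfl

/-- The update of stream `j` chosen at step `n` has index equal to its count so far. The substantial
point is `surj`: merged arrivals tend to infinity, so every update is eventually reached. -/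
theorem isMerging {lam p q : ℝ} (hlam : 0 < lam) (hz : ∀ p, 0 < z (.inl p))
    (hfirst : ∀ n, ∃ j, IsFirst j ((nextState i)^[n] z))
    (ht : Typical i lam p q fun n => output i ((extStep i)^[n] (initial i z))) :
    IsMerging (fun j n => z (.inl (j, n))) (fun j n => z (.inr (j, n))) (nextWait i z)
      (fun n => output i ((extStep i)^[n] (initial i z)))
      (fun n => streamCount i z n (nextStream i ((nextState i)^[n] z))) where
  interarrival_pos j n := hz _
  first_pos := hz _
  wait_pos := ht.wait_pos
  service_nonneg := ht.service_nonneg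
  genTime_eq n := by
    rw [arrival_eq_elapsed, elapsed, Finset.sum_range_succ]
    have := (iterate_nextState_eq i z n (nextStream i ((nextState i)^[n] z))).1
    simp only [iterate_extStep_initial, output, nextWait]
    rw [this, elapsed]
    simp only [nextWait]
    ring
  service_eq n := by
    have := (iterate_nextState_eq i z n (nextStream i ((nextState i)^[n] z))).2.2 0
    simp only [iterate_extStep_initial, output, nextService]
    rw [this, add_zero]
  surj j m := by
    have hinf : Tendsto (arrival (nextWait i z)
        fun n => output i ((extStep i)^[n] (initial i z))) atTop atTop := by
      have h := (ht.tendsto_arrival_div (nextWait i z)).pos_mul_atTop (one_div_pos.2 hlam)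
        tendsto_natCast_atTop_atTop
      refine h.congr' ?_
      filter_upwards [eventually_ge_atTop 1] with n hn
      have : (n : ℝ) ≠ 0 := by positivity
      field_simp
    have hx : ∀ (j : Fin M) n, 0 < (fun j n => z (.inl (j, n)) : Fin M → ℕ → ℝ) j n :=
      fun j n => hz _
    -- The next merged arrival never comes after the next pending generation of stream `j`; once it
    -- is past generation `m`, the pending index exceeds `m`.
    have hgt : ∃ n, m < streamCount i z n j := by
      obtain ⟨n, hn⟩ := (hinf.eventually_gt_atTop
        (genTime (fun j n => z (.inl (j, n))) j m)).exists
      refine ⟨n, ?_⟩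
      rw [← (genTime_strictMono hx j).lt_iff_lt]
      refine hn.trans_le ?_
      rw [arrival_eq_elapsed, elapsed, Finset.sum_range_succ]
      have h1 := (iterate_nextState_eq i z n j).1
      rw [elapsed] at h1
      obtain ⟨k, hk⟩ := hfirst n
      have h2 : nextWait i ((nextState i)^[n] z) ≤ (nextState i)^[n] z (.inl (j, 0)) := by
        rw [nextWait, nextStream_eq i hk]
        by_cases hjk : j = k
        · rw [hjk]
        · exact (hk.lt hjk).le
      linarith
    classical
    -- At the first time the count exceeds `m`, the preceding step increased it from `m`, so that
    -- step is update `m` of stream `j`.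
    have hspec := Nat.find_spec hgt
    have hne : Nat.find hgt ≠ 0 := fun h => by rw [h] at hspec; simp [streamCount] at hspec
    obtain ⟨n, hn⟩ := Nat.exists_eq_succ_of_ne_zero hne
    have hmin := not_lt.1 (Nat.find_min hgt (m := n) (by omega))
    rw [hn, streamCount] at hspec
    have hj : j = nextStream i ((nextState i)^[n] z) := by
      by_contra h
      rw [if_neg h] at hspec
      omega
    refine ⟨n, ?_, ?_⟩
    · simp only [iterate_extStep_initial, output]
      exact hj.symm
    · rw [if_pos hj] at hspec
      simp only [← hj]
      omega

variable {rate : Fin M → ℝ} {ν : Measure ℝ} [IsProbabilityMeasure ν]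

/-- After the first update the extended chain is in its stationary law; the initial wait, which has
no update before it, is discarded. -/
theorem map_initial (hr : ∀ i, 0 < rate i) :
    (pathMeasure rate ν).map (initial i) = ((streamLaw rate).prod ν).prod (pathMeasure rate ν) := by
  have hp' := isProbabilityMeasure_pathMeasure hr ν
  have hpos : 0 < ∑ k, rate k := Finset.sum_pos (fun k _ => hr k) ⟨i, Finset.mem_univ i⟩
  have := isProbabilityMeasure_expMeasure hpos
  have := isProbabilityMeasure_streamLaw hr i
  have h := congrArg (Measure.map (Prod.map Prod.snd id)) (map_next_pathMeasure (ν := ν) hr i)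
  rw [Measure.map_map (by fun_prop) (measurable_next i),
    ← Measure.map_prod_map _ _ measurable_snd measurable_id, Measure.map_id,
    Measure.map_snd_prod, measure_univ, one_smul] at h
  exact h

theorem laplace_pos {l : ℝ} (hl : 0 ≤ l) (hν : ∀ᵐ t ∂ν, 0 ≤ t) : 0 < laplace ν l := by
  have hint : Integrable (fun t => Real.exp (-l * t)) ν := by
    refine Integrable.of_bound (by fun_prop) 1 ?_
    filter_upwards [hν] with t ht
    rw [Real.norm_of_nonneg (Real.exp_pos _).le, Real.exp_le_one_iff]
    nlinarith [mul_nonneg hl ht]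
  exact integral_exp_pos hint

theorem ae_pathMeasure (hr : ∀ i, 0 < rate i) (hν : ∀ᵐ t ∂ν, 0 ≤ t) {lam : ℝ}
    (hlam : lam = ∑ k, rate k) :
    ∀ᵐ z ∂(pathMeasure rate ν), (∀ p, 0 < z (.inl p)) ∧
      (∀ n, ∃ j, IsFirst j ((nextState i)^[n] z)) ∧
      Typical i lam (rate i / lam * laplace ν lam)
        (rate i / lam * ∫ t, t * Real.exp (-lam * t) ∂ν)
        fun n => output i ((extStep i)^[n] (initial i z)) := by
  have hp := isProbabilityMeasure_pathLaw hr ν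
  have hp' := isProbabilityMeasure_pathMeasure hr ν
  have hpos : 0 < ∑ k, rate k := Finset.sum_pos (fun k _ => hr k) ⟨i, Finset.mem_univ i⟩
  have := isProbabilityMeasure_expMeasure hpos
  have := isProbabilityMeasure_streamLaw hr i
  have h1 : ∀ᵐ z ∂(pathMeasure rate ν), ∀ p : Fin M × ℕ, 0 < z (.inl p) := by
    refine ae_all_iff.2 fun p => ?_
    have hmp : MeasurePreserving (fun z : Idx M → ℝ => z (.inl p)) (pathMeasure rate ν)
        (expMeasure (rate p.1)) := measurePreserving_eval_infinitePi (pathLaw rate ν) (.inl p)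
    exact hmp.quasiMeasurePreserving.ae (ae_pos_expMeasure _)
  have hnext : MeasurePreserving (nextState i) (pathMeasure rate ν) (pathMeasure rate ν) :=
    measurePreserving_of_map_prodMk_eq (by fun_prop) (measurable_nextState i)
      (map_next_pathMeasure hr i)
  have h2 : ∀ᵐ z ∂(pathMeasure rate ν), ∀ n, ∃ j, IsFirst j ((nextState i)^[n] z) :=
    ae_all_iff.2 fun n => (hnext.iterate n).quasiMeasurePreserving.ae (ae_exists_isFirst hr i)
  have hO := isProbabilityMeasure_outLaw (ν := ν) hr i
  have h3 := ae_typical (P := ((streamLaw rate).prod ν).prod (pathMeasure rate ν)) hr hν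
    (V := fun n q => output i ((extStep i)^[n] q))
    (fun n => (measurable_output i).comp ((measurable_extStep i).iterate n))
    (iIndepFun_iterate_of_map_prodMk_eq (measurable_output i) (measurable_extStep i)
      (map_output_extStep hr i))
    (hasLaw_iterate_of_map_prodMk_eq (measurable_output i) (measurable_extStep i)
      (map_output_extStep hr i)) i hlam (laplace_pos (hlam ▸ hpos.le) hν)
  rw [← map_initial i hr] at h3
  have hinit : Measurable (initial (M := M) i) :=
    Measurable.prodMk (by fun_prop) (measurable_nextState i)
  filter_upwards [h1, h2, ae_of_ae_map hinit.aemeasurable h3] with z h1 h2 h3 using ⟨h1, h2, h3⟩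

end Merge

end MG11

end

/-! ### Transfer to the given probability space. -/

theorem mainTheorem1 {Ω : Type*} [MeasurableSpace Ω] (P : Measure Ω) [IsProbabilityMeasure P]
    {M : ℕ} (rate : Fin M → ℝ) (ν : Measure ℝ) [IsProbabilityMeasure ν]
    (X S : Fin M → ℕ → Ω → ℝ) (hmodel : MG11.IsModel P rate ν X S)
    (lam : ℝ) (hlam : lam = ∑ i, rate i)
    (i : Fin M) (a₀ : ℝ) (ha₀ : 0 ≤ a₀) :
    ∀ᵐ ω ∂P,
      -- the average age, as the limit of time averages of the instantaneous age
      ((∀ τ : ℝ, IntervalIntegrable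
          (MG11.age (fun j n => X j n ω) (fun j n => S j n ω) a₀ i) volume 0 τ) ∧
        Tendsto (fun τ : ℝ => (1 / τ) * ∫ t in (0 : ℝ)..τ,
            MG11.age (fun j n => X j n ω) (fun j n => S j n ω) a₀ i t)
          atTop (𝓝 (1 / (rate i * MG11.laplace ν lam)))) ∧
      -- the average peak age, as the limit of the averages of the first `N` peaks
      ({n | MG11.Successful (fun j n => X j n ω) (fun j n => S j n ω) i n}.Infinite ∧
        Tendsto (fun N : ℕ => (1 / (N : ℝ)) * ∑ j ∈ Finset.range N,
            MG11.peakAge (fun j n => X j n ω) (fun j n => S j n ω) a₀ i j)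
          atTop (𝓝 (1 / (rate i * MG11.laplace ν lam) +
            (∫ t, t * Real.exp (-lam * t) ∂ν) / MG11.laplace ν lam))) := by
  have hr := hmodel.rate_pos
  have hν := hmodel.service_nonneg
  have hpos : 0 < lam := hlam ▸ Finset.sum_pos (fun k _ => hr k) ⟨i, Finset.mem_univ i⟩
  have hL : 0 < MG11.laplace ν lam := MG11.laplace_pos hpos.le hν
  have hp : 0 < rate i / lam * MG11.laplace ν lam := mul_pos (div_pos (hr i) hpos) hL
  have hcoord : ∀ a : MG11.Idx M, HasLaw (Sum.elim (fun p : Fin M × ℕ => X p.1 p.2)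
      (fun p : Fin M × ℕ => S p.1 p.2) a) (MG11.pathLaw rate ν a) P := by
    rintro (p | p)
    · exact hmodel.law_interarrival p.1 p.2
    · exact hmodel.law_service p.1 p.2
  -- Independence and the marginals fix the joint law as `pathMeasure`, so its almost sure
  -- statements pull back to `P`.
  have hlaw := hmodel.indep.hasLaw_infinitePi hcoord
    (aemeasurable_pi_iff.2 fun a => (hcoord a).aemeasurable)
  have hae := MG11.ae_pathMeasure (ν := ν) i hr hν hlam
  rw [MG11.pathMeasure, ← hlaw.map_eq] at hae
  filter_upwards [ae_of_ae_map hlaw.aemeasurable hae] with ω hω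
  obtain ⟨h1, h2, ht⟩ := hω
  have hm := MG11.isMerging i _ hpos h1 h2 ht
  have hri := hr i
  refine ⟨⟨fun τ => hm.intervalIntegrable_age ha₀ i 0 τ, ?_⟩,
    hm.infinite_successful i (ht.infinite_suc hp), ?_⟩
  · have h := hm.tendsto_average_age ha₀ ht hpos hp
    have hlim : 1 / (lam * (rate i / lam * MG11.laplace ν lam)) =
        1 / (rate i * MG11.laplace ν lam) := by field_simp
    rw [hlim] at h
    exact h
  · have h := hm.tendsto_average_peakAge ha₀ ht hp
    have hlim : (rate i / lam * (∫ t, t * Real.exp (-lam * t) ∂ν) + 1 / lam) /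
        (rate i / lam * MG11.laplace ν lam) = 1 / (rate i * MG11.laplace ν lam) +
          (∫ t, t * Real.exp (-lam * t) ∂ν) / MG11.laplace ν lam := by
      field_simp
      ring
    rw [hlim] at h
    exact h
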